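/- **Setting.** A *square* is a point of $\mathbb{Z}^2$ (the center of a unit square of the infinite chessboard); a *board* is a set of squares. Let $p, q$ be nonnegative integers, not both zero. A *$(p,q)$-leaper* $L$ moves from a square $a$ to any of $a + (\pm p, \pm q)$, $a + (\pm q, \pm p)$; a leaper is determined by the unordered pair of its proportions. The *leaper graph* of $L$ over a board $B$ has vertex set $B$ and joins the pairs of squares of $B$ that are joined by a move of $L$. A board $B$ is *dual* with respect to two distinct leapers if it contains more than one square and the leaper graphs of the two leapers over $B$ are connected and isomorphic. **Frames and liftings.** For $0 < m < n$ with $m + n$ odd, the *$(m,n)$-frame* $F$ is the $(m+n)\times(m+n)$ board centered at the origin with its central $(n-m)\times(n-m)$ squares removed; extending the sides of the hole dissects $F$ into eight *sections* $F_i$, $i = \mathrm{E}, \mathrm{NE}, \ldots, \mathrm{SE}$ (indices modulo 8, counterclockwise). If moreover $n \le 3m$, the *shell* of $F$ is the union of the eight subboards of size $(n-m)\times(n-m)$ in the corners and adjacent by side to the hole (when $n \le 2m$), or of the eight subboards of size $(3m-n)\times(3m-n)$ in the middles of the outer sides and adjacent by corner to the hole (when $2m \le n$). The liftings $f$, $g$,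 $h$ take $F$ to the $(m', n')$-frame $H$ with $(m',n') = (m, 2m+n)$, $(n, 2n-m)$, $(n, m+2n)$, respectively. Let $v_i$ be the translation in direction $i$ by a move of a $(0,m+n)$-, $(0,n-m)$-, $(0,m+n)$-leaper (for $f$, $g$, $h$, respectively) if $i$ is one of $\mathrm{E},\mathrm{N},\mathrm{W},\mathrm{S}$, and by a move of an $(m,m)$-, $(n,n)$-, $(n,n)$-leaper if $i$ is a diagonal direction. A set $S \subseteq F$ is lifted to $\bigcup_i (S + v_i) \cap H_i$. A cycle $a^{\mathrm{E}} a^{\mathrm{NE}} \cdots a^{\mathrm{SE}}$, with path $a^i$ within $F_i$, is lifted to $b^{\mathrm{E}} b^{\mathrm{NE}} \cdots b^{\mathrm{SE}}$, where, with $-w$ denoting the reversal of a path $w$: - for $f$: $b^i = -a^{i+5}\,{-a^{i+4}}\,{-a^{i+3}} + v_i$ for $i = \mathrm{E},\mathrm{N},\mathrm{W},\mathrm{S}$ and $b^i = a^i + v_i$ otherwise; - for $g$: $b^i = a^i + v_i$ for $i = \mathrm{E},\mathrm{N},\mathrm{W},\mathrm{S}$ and $b^i = -a^{i+5}\,{-a^{i+4}}\,{-a^{i+3}}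 + v_i$ otherwise; - for $h$: $b^i = -a^{i+6}\,{-a^{i+5}}\,{-a^{i+4}}\,{-a^{i+3}}\,{-a^{i+2}} + v_i$ for $i = \mathrm{E},\mathrm{N},\mathrm{W},\mathrm{S}$ and $b^i = a^{i-1}a^{i}a^{i+1} + v_i$ otherwise. **Canonical second leaper.** For a cycle $C$ of a $(p,q)$-leaper, $0 < p < q$, $p$ and $q$ relatively prime, $p + q$ odd, within the $(p,q)$-frame, the *canonical second leaper* $M$ and the *canonical second leaper cycle* $D$ over the squares of $C$ are defined recursively. - If $(p,q) = (1,2)$, then $M$ is the $(0,1)$-leaper and $D$ visits the eight squares of the frame in counterclockwise order. - If $(p,q) = (n, 2n-m)$ or $(n, m+2n)$, where $0 < m < n$ are relatively prime and $m+n$ is odd, and $C$ lies within the shell of the $(p,q)$-frame (then $C$ has exactly one square in each section), then $M$ is the $(m,n)$-leaper and $D$ visits the squares of $C$ in the counterclockwise order of their sections. - Otherwise, the squares of $C$ are the lift by $f$, $g$ or $h$ of the squares of a cycle $A$ of an $(m,n)$-leaper within the $(m,n)$-frame; then $M$ is the canonical second leaper associated with $A$, and $D$ is the lift of the canonical second leaper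 cycle over the squares of $A$. For an arbitrary $(p,q)$-leaper with $p+q$ odd, let $d$ be the greatest common divisor of $p$ and $q$. A cycle $C$ within a $(p+q)\times(p+q)$ chessboard is the image under some map $x \mapsto t + dx$ of a cycle as above of the $(p/d,q/d)$-leaper (proportions taken in increasing order); its canonical second leaper has $d$ times the proportions of that of the latter cycle, and its canonical second leaper cycle is the image of that of the latter cycle under the same map. **Theorem.** Let $L$ be a $(p, q)$-leaper with $p + q$ odd and let $C$ be a cycle of $L$ within a $(p + q) \times (p + q)$ chessboard. Then the canonical second leaper $M$ associated with $C$ and the canonical second leaper cycle $D$ of $M$ over the squares of $C$ exist; $D$ is a Hamiltonian cycle of $M$ over the squares of $C$, and $D$ is exactly the leaper graph of $M$ over the squares of $C$. Moreover, $C$ is exactly the leaper graph of $L$ over these squares, $M$ is distinct from $L$, and the leaper graphs of $L$ and $M$ over the board formed by the squares of $C$ are isomorphic cycles; so this board is dual with respect to $L$ and $M$. -/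

import Mathlib

/-- A square of the infinite chessboard, named by the integer coordinates of its center. -/
abbrev Square : Type := ℤ × ℤ

/-- The leaper graph of a `(p, q)`-leaper over the infinite chessboard: two distinct squares are
adjacent when their difference is `(±p, ±q)` or `(±q, ±p)`.  The leaper graph over a board `B` is
the subgraph induced by `B`. -/
def leaperGraph (p q : ℕ) : SimpleGraph Square where
  Adj a b := a ≠ b ∧
    (((b.1 - a.1).natAbs = p ∧ (b.2 - a.2).natAbs = q) ∨
      ((b.1 - a.1).natAbs = q ∧ (b.2 - a.2).natAbs = p))
  symm := ⟨by
    rintro a b ⟨hne, h⟩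
    refine ⟨hne.symm, ?_⟩
    rw [← Int.natAbs_neg (b.1 - a.1), ← Int.natAbs_neg (b.2 - a.2), neg_sub, neg_sub] at h
    exact h⟩
  loopless := ⟨fun _ h => h.1 rfl⟩

/-- The `k × k` chessboard whose southwest square is `o`. -/
def chessboard (k : ℕ) (o : Square) : Set Square :=
  {x | (o.1 ≤ x.1 ∧ x.1 < o.1 + k) ∧ (o.2 ≤ x.2 ∧ x.2 < o.2 + k)}

/-- The squares visited by a closed walk. -/
def squares {p q : ℕ} {u : Square} (C : (leaperGraph p q).Walk u u) : Set Square :=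
  {x | x ∈ C.support}

/-- A board is dual with respect to two distinct leapers (a leaper being given by the unordered
pair of its proportions) if it has more than one square and the two leaper graphs over it are
connected and isomorphic. -/
def IsDualBoard (B : Set Square) (p q r s : ℕ) : Prop :=
  s(p, q) ≠ s(r, s) ∧ B.Nontrivial ∧
    ((leaperGraph p q).induce B).Connected ∧ ((leaperGraph r s).induce B).Connected ∧
    Nonempty ((leaperGraph p q).induce B ≃g (leaperGraph r s).induce B)

/-! ### Frames, sections and shells

Directions E, NE, N, NW, W, SW, S, SE are `0, 1, ..., 7 : Fin 8`, so that `i + k` is the direction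
`k` steps counterclockwise from `i`.  All frames are centered at the square `(0, 0)`, which is the
common center when `m + n` is odd. -/

/-- The sign vector of a direction. -/
def dirVec : Fin 8 → Square :=
  ![(1, 0), (1, 1), (0, 1), (-1, 1), (-1, 0), (-1, -1), (0, -1), (1, -1)]

/-- The directions E, N, W, S. -/
def IsSide (i : Fin 8) : Prop := i.val % 2 = 0

instance (i : Fin 8) : Decidable (IsSide i) := inferInstanceAs (Decidable (i.val % 2 = 0))

/-- The `(m, n)`-frame, `m < n`: an `(m + n) × (m + n)` chessboard with an `(n - m) × (n - m)` hole
in the center. -/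
def frame (m n : ℕ) : Set Square :=
  {x | (|2 * x.1| < (m : ℤ) + n ∧ |2 * x.2| < (m : ℤ) + n) ∧
    ¬ (|2 * x.1| < (n : ℤ) - m ∧ |2 * x.2| < (n : ℤ) - m)}

/-- The section `F_i` of the `(m, n)`-frame: the frame is cut along the extended sides of its
central hole. -/
def frameSection (m n : ℕ) (i : Fin 8) : Set Square :=
  let band : ℤ → ℤ → Prop := fun e t =>
    if e = 0 then |2 * t| < (n : ℤ) - m
    else (n : ℤ) - m < 2 * (e * t) ∧ 2 * (e * t) < (m : ℤ) + n
  {x | band (dirVec i).1 x.1 ∧ band (dirVec i).2 x.2}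

/-- The part of the shell of the `(m, n)`-frame (`m < n ≤ 3 * m`) in direction `i`.
If `n ≤ 2 * m`, these are eight boards of size `(n - m) × (n - m)`: one in each corner of the frame
and four adjacent by side to the central hole.  If `2 * m ≤ n`, they are eight boards of size
`(3 * m - n) × (3 * m - n)`: one in the middle of each outer side of the frame and four adjacent by
corner to the central hole. -/
def shellPart (m n : ℕ) (i : Fin 8) : Set Square :=
  let box : ℤ → ℤ → ℤ → Set Square := fun mid lo hi =>
    {x | (if (dirVec i).1 = 0 then |2 * x.1| < mid
          else lo < 2 * ((dirVec i).1 * x.1) ∧ 2 * ((dirVec i).1 * x.1) < hi) ∧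
         (if (dirVec i).2 = 0 then |2 * x.2| < mid
          else lo < 2 * ((dirVec i).2 * x.2) ∧ 2 * ((dirVec i).2 * x.2) < hi)}
  if n ≤ 2 * m then
    if IsSide i then box ((n : ℤ) - m) ((n : ℤ) - m) (3 * ((n : ℤ) - m))
    else box 0 (3 * (m : ℤ) - n) ((m : ℤ) + n)
  else
    if IsSide i then box (3 * (m : ℤ) - n) (3 * (n : ℤ) - 5 * m) ((m : ℤ) + n)
    else box 0 ((n : ℤ) - m) (5 * (m : ℤ) - n)

/-- The shell of the `(m, n)`-frame. -/
def shell (m n : ℕ) : Set Square := {x | ∃ i, x ∈ shellPart m n i}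

/-! ### The three lifting transformations -/

/-- The translation in direction `i` by a `(0, k)`-move (sides) or an `(l, l)`-move (corners). -/
def liftVec (k l : ℤ) (i : Fin 8) : Square := if IsSide i then k • dirVec i else l • dirVec i

/-- `f` lifts an `(m, n)`-frame to an `(m, 2 * m + n)`-frame. -/
def fVec (m n : ℕ) : Fin 8 → Square := liftVec ((m : ℤ) + n) m

/-- `g` lifts an `(m, n)`-frame to an `(n, 2 * n - m)`-frame. -/
def gVec (m n : ℕ) : Fin 8 → Square := liftVec ((n : ℤ) - m) n

/-- `h` lifts an `(m, n)`-frame to an `(n, m + 2 * n)`-frame. -/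
def hVec (m n : ℕ) : Fin 8 → Square := liftVec ((m : ℤ) + n) n

/-- The union over all directions `i` of `(S + v i) ∩ H_i`, for `H` the `(m', n')`-frame. -/
def liftSet (v : Fin 8 → Square) (m' n' : ℕ) (S : Set Square) : Set Square :=
  {x | ∃ i, x ∈ frameSection m' n' i ∧ x - v i ∈ S}

/-- An oriented cycle within a frame, cut into eight consecutive paths, one in each section:
the cycle is the concatenation `a E, a NE, ..., a SE`. -/
abbrev SectionPaths : Type := Fin 8 → List Square

/-- The cyclic sequence of squares of such a cycle. -/
def SectionPaths.concat (a : SectionPaths) : List Square := (List.finRange 8).flatMap a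

/-- Translation of a path. -/
def shiftPath (v : Square) (w : List Square) : List Square := w.map (fun x => x + v)

/-- The effect of `f` on a cycle. -/
def fPaths (m n : ℕ) (a : SectionPaths) : SectionPaths := fun i =>
  shiftPath (fVec m n i)
    (if IsSide i then (a (i + 5)).reverse ++ (a (i + 4)).reverse ++ (a (i + 3)).reverse else a i)

/-- The effect of `g` on a cycle. -/
def gPaths (m n : ℕ) (a : SectionPaths) : SectionPaths := fun i =>
  shiftPath (gVec m n i)
    (if IsSide i then a i else (a (i + 5)).reverse ++ (a (i + 4)).reverse ++ (a (i + 3)).reverse)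

/-- The effect of `h` on a cycle. -/
def hPaths (m n : ℕ) (a : SectionPaths) : SectionPaths := fun i =>
  shiftPath (hVec m n i)
    (if IsSide i then
      (a (i + 6)).reverse ++ (a (i + 5)).reverse ++ (a (i + 4)).reverse ++ (a (i + 3)).reverse ++
        (a (i + 2)).reverse
    else a (i + 7) ++ a i ++ a (i + 1))

/-! ### Canonical second leapers -/

/-- `BasicCanonical p q S r s a`: here `S` is the vertex set of a cycle of the skew basic
`(p, q)`-leaper, `p < q`, within the centered `(p, q)`-frame, the canonical second leaper
associated with it is the `(r, s)`-leaper, and the canonical second leaper cycle over `S` is the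
concatenation of the paths `a`. -/
inductive BasicCanonical : ℕ → ℕ → Set Square → ℕ → ℕ → SectionPaths → Prop
  /-- The `(1, 2)`-frame is toured by the `(0, 1)`-leaper. -/
  | base : BasicCanonical 1 2 (frame 1 2) 0 1 (fun i => [dirVec i])
  /-- A cycle within the shell of the `(n, 2 * n - m)`-frame has one square in each section, and
  these are visited in their counterclockwise order by an `(m, n)`-leaper. -/
  | gShell {m n : ℕ} (hm : 0 < m) (hmn : m < n) (hodd : Odd (m + n)) (hco : Nat.Coprime m n)
      {u : Square} (C : (leaperGraph n (2 * n - m)).Walk u u) (hC : C.IsCycle)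
      (hshell : squares C ⊆ shell n (2 * n - m))
      (x : Fin 8 → Square) (hx : ∀ i, x i ∈ frameSection n (2 * n - m) i)
      (hS : squares C = Set.range x) :
      BasicCanonical n (2 * n - m) (squares C) m n (fun i => [x i])
  /-- The same for the shell of the `(n, m + 2 * n)`-frame. -/
  | hShell {m n : ℕ} (hm : 0 < m) (hmn : m < n) (hodd : Odd (m + n)) (hco : Nat.Coprime m n)
      {u : Square} (C : (leaperGraph n (m + 2 * n)).Walk u u) (hC : C.IsCycle)
      (hshell : squares C ⊆ shell n (m + 2 * n))
      (x : Fin 8 → Square) (hx : ∀ i, x i ∈ frameSection n (m + 2 * n) i)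
      (hS : squares C = Set.range x) :
      BasicCanonical n (m + 2 * n) (squares C) m n (fun i => [x i])
  /-- All other cycles, and the second leaper cycles over them, arise by lifting. -/
  | fLift {m n : ℕ} {S : Set Square} {r s : ℕ} {a : SectionPaths}
      (h : BasicCanonical m n S r s a) :
      BasicCanonical m (2 * m + n) (liftSet (fVec m n) m (2 * m + n) S) r s (fPaths m n a)
  | gLift {m n : ℕ} {S : Set Square} {r s : ℕ} {a : SectionPaths}
      (h : BasicCanonical m n S r s a) :
      BasicCanonical n (2 * n - m) (liftSet (gVec m n) n (2 * n - m) S) r s (gPaths m n a)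
  | hLift {m n : ℕ} {S : Set Square} {r s : ℕ} {a : SectionPaths}
      (h : BasicCanonical m n S r s a) :
      BasicCanonical n (m + 2 * n) (liftSet (hVec m n) n (m + 2 * n) S) r s (hPaths m n a)

/-- For a cycle of a `(p, q)`-leaper, `p + q` odd, with set of squares `B` within some
`(p + q) × (p + q)` chessboard: the canonical second leaper is the `(r, s)`-leaper, and the
canonical second leaper cycle is the cyclic sequence of squares `D`.  A cycle of an arbitrary leaper
is a translated and scaled (by the greatest common divisor `d` of `p` and `q`) copy of a cycle of a
basic leaper, and the second leaper and its cycle are scaled and translated accordingly. -/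
def IsCanonicalSecond (p q : ℕ) (B : Set Square) (r s : ℕ) (D : List Square) : Prop :=
  ∃ (p' q' r' s' d : ℕ) (t : Square) (S : Set Square) (a : SectionPaths),
    BasicCanonical p' q' S r' s' a ∧ 0 < d ∧ s(p, q) = s(d * p', d * q') ∧
    B = (fun x : Square => t + (d : ℤ) • x) '' S ∧
    r = d * r' ∧ s = d * s' ∧
    D = a.concat.map (fun x : Square => t + (d : ℤ) • x)

/-!
When `p + q` is odd, every square of a `(p + q) × (p + q)` chessboard has at most two neighbors
under the `(p, q)`-leaper. A cycle on such a board is therefore a whole component of the leaper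
graph, without chords. Squares of the central hole have no neighbors at all, so the cycle is a
component over the frame.

A move between two copies of squares in a lifted frame projects either to a move between the
originals or to another copy of the same square. Hence a component over the lifted frame either
consists of eight translates of a single square, which lie in the shell, or is the lift of a
component over the smaller frame. Euclid's algorithm on the proportions of the leaper thus reduces
every cycle to one in a shell or to the `(1, 2)`-frame, where the second leaper is found by hand.

Second leaper cycles survive the liftings because of a symmetry: the move of the first leaper that
takes two adjacent sections of the frame to the opposite two reverses the tour. A lifting copies
arcs of consecutive sections, and neighboring copies are translated by vectors that differ by such a
move, so the pieces fit together. The moves of the second leaper join only squares of equal or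
adjacent sections that are consecutive on the tour, so no chords appear.
-/

section Graphs

open SimpleGraph

variable {V W : Type*} {G : SimpleGraph V} {u : V}

lemma nonempty_iso_cycleGraph_of_isChordless {C : G.Walk u u} (hC : C.IsCycle)
    (hch : C.IsChordless) : Nonempty (cycleGraph C.length ≃g G.induce {x | x ∈ C.support}) := by
  obtain ⟨n, hn⟩ : ∃ n, C.length = n + 2 := ⟨C.length - 2, by have := hC.three_le_length; omega⟩
  rw [hn]
  let φ : Fin (n + 2) → {x | x ∈ C.support} := fun i => ⟨C.getVert i, C.getVert_mem_support i⟩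
  have hinj : φ.Injective := fun i j hij => Fin.ext <|
    hC.getVert_injOn' (by grind) (by grind) (congrArg Subtype.val hij)
  have hlast : C.getVert (n + 2) = C.getVert 0 := by rw [← hn, C.getVert_length, C.getVert_zero]
  have hsurj : φ.Surjective := by
    rintro ⟨x, hx⟩
    obtain ⟨k, rfl, hk⟩ := Walk.mem_support_iff_exists_getVert.mp hx
    rcases (hn ▸ hk).lt_or_eq with hlt | rfl
    · exact ⟨⟨k, hlt⟩, rfl⟩
    · exact ⟨0, Subtype.ext hlast.symm⟩
  have hsucc (k : Fin (n + 2)) : C.getVert (k + 1) = φ (k + 1) := by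
    rcases eq_or_ne k (Fin.last _) with rfl | hk
    · simpa [φ] using hlast
    · simp [φ, Fin.val_add_one_of_lt (Fin.lt_last_iff_ne_last.mpr hk)]
  have hadj (i j : Fin (n + 2)) : G.Adj (φ i) (φ j) ↔ ∃ k, s(φ k, φ (k + 1)) = s(φ i, φ j) := by
    have hind : C.toSubgraph.Adj (φ i) (φ j) ↔ G.Adj (φ i) (φ j) :=
      ⟨Subgraph.Adj.adj_sub, Walk.isInduced_toSubgraph.mpr hch (by simp [φ]) (by simp [φ])⟩
    rw [← hind, C.toSubgraph_adj_iff, hn]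
    constructor
    · rintro ⟨k, hk, hlt⟩
      refine ⟨⟨k, hlt⟩, Sym2.map.injective Subtype.val_injective ?_⟩
      simpa [← hsucc] using hk
    · rintro ⟨k, hk⟩
      exact ⟨k, by simpa [hsucc] using congrArg (Sym2.map Subtype.val) hk, k.2⟩
  refine ⟨⟨Equiv.ofBijective φ ⟨hinj, hsurj⟩, fun {i j} => (hadj i j).trans ?_⟩⟩
  simp only [Sym2.eq_iff, hinj.eq_iff, cycleGraph_adj]
  grind

lemma isChordless_map {H : SimpleGraph W} (f : G ↪g H) {v : V} {C : G.Walk u v}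
    (hC : C.IsChordless) : (C.map f.toHom).IsChordless := by
  refine Walk.isChordless_iff_forall_mem_edges.mpr fun x y hx hy hxy => ?_
  rw [Walk.support_map, List.mem_map] at hx hy
  obtain ⟨x, hx, rfl⟩ := hx
  obtain ⟨y, hy, rfl⟩ := hy
  rw [Walk.edges_map]
  exact List.mem_map_of_mem (f := Sym2.map f) (hC.mem_edges hx hy (f.map_adj_iff.mp hxy))

lemma toSubgraph_eq_induce_of_isChordless {C : G.Walk u u} (hch : C.IsChordless) :
    C.toSubgraph = (⊤ : G.Subgraph).induce {x | x ∈ C.support} := by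
  rw [← C.verts_toSubgraph, (Walk.isInduced_toSubgraph.mpr hch).induce_top_verts]

lemma nonempty_iso_of_isChordless {G' : SimpleGraph V} {w : V} {C : G.Walk u u} {E : G'.Walk w w}
    (hC : C.IsCycle) (hE : E.IsCycle) (hC' : C.IsChordless) (hE' : E.IsChordless)
    (h : {x | x ∈ C.support} = {x | x ∈ E.support}) :
    Nonempty (G.induce {x | x ∈ C.support} ≃g G'.induce {x | x ∈ C.support}) := by
  obtain ⟨φ⟩ := nonempty_iso_cycleGraph_of_isChordless hC hC'
  obtain ⟨ψ⟩ := nonempty_iso_cycleGraph_of_isChordless hE hE'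
  rw [← h] at ψ
  have hlen : C.length = E.length := by
    simpa using Nat.card_congr (φ.toEquiv.trans ψ.symm.toEquiv)
  rw [← hlen] at ψ
  exact ⟨φ.symm.trans ψ⟩

lemma exists_isCycle_of_isChain {w : V} {D : List V} (hnd : (w :: D).Nodup) (hlen : 2 ≤ D.length)
    (hch : (w :: D ++ [w]).IsChain G.Adj) :
    ∃ E : G.Walk w w, E.IsCycle ∧ E.support = w :: D ++ [w] := by
  obtain ⟨E, hs⟩ : ∃ E : G.Walk w w, E.support = w :: D ++ [w] :=
    ⟨(Walk.ofSupport (w :: D ++ [w]) (by simp) hch).copy (by simp) (by simp),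
      (Walk.support_copy _ _ _).trans (Walk.support_ofSupport _ _)⟩
  have hl : E.length + 1 = D.length + 2 := by
    rw [← Walk.length_support, hs]; simp
  refine ⟨E, Walk.isCycle_iff_isPath_tail_and_le_length.mpr ⟨?_, by omega⟩, hs⟩
  have hnil : ¬ E.Nil := by rw [← Walk.length_eq_zero_iff]; omega
  rw [Walk.isPath_def, E.support_tail_of_not_nil hnil, hs]
  exact (List.perm_append_singleton w D).nodup_iff.mpr hnd

/-- Every edge of `G` from a vertex of `T` in `F` to a vertex of `F` leads to a vertex of `T`. -/
def IsClosedIn (G : SimpleGraph V) (F T : Set V) : Prop :=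
  ∀ x ∈ T, x ∈ F → ∀ y ∈ F, G.Adj x y → y ∈ T

/-- `S` is the vertex set of a connected component of the subgraph of `G` induced by `F`, described
as a minimal nonempty subset of `F` closed under adjacency in `F`. -/
structure IsComponentOf (G : SimpleGraph V) (F S : Set V) : Prop where
  nonempty : S.Nonempty
  subset : S ⊆ F
  isClosedIn : IsClosedIn G F S
  subset_of_isClosedIn : ∀ T, IsClosedIn G F T → (S ∩ T).Nonempty → S ⊆ T

lemma support_subset_of_isClosedIn {F T : Set V} {v : V} {C : G.Walk u v}
    (hF : {x | x ∈ C.support} ⊆ F) (hT : IsClosedIn G F T)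
    (hne : ({x | x ∈ C.support} ∩ T).Nonempty) : {x | x ∈ C.support} ⊆ T := by
  obtain ⟨x₀, hx₀, hx₀T⟩ := hne
  intro y hy
  by_contra hyT
  have hconn : (G.induce {x | x ∈ C.support}).Connected := C.connected_induce_support
  obtain ⟨p⟩ := hconn.preconnected ⟨x₀, hx₀⟩ ⟨y, hy⟩
  obtain ⟨d, -, hd, hd'⟩ := p.exists_boundary_dart {z | z.1 ∈ T} hx₀T hyT
  exact hd' (hT _ hd (hF d.fst.2) _ (hF d.snd.2) d.adj)

namespace IsComponentOf

variable {F S : Set V}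

lemma exists_adj (hS : IsComponentOf G F S) (hne : S.Nontrivial) {x : V} (hx : x ∈ S) :
    ∃ y ∈ F, G.Adj x y := by
  by_contra! h
  refine hne.not_subset_singleton (hS.subset_of_isClosedIn {x} ?_ ⟨x, hx, rfl⟩)
  rintro _ rfl - y hy hxy
  exact absurd hxy (h y hy)

lemma mono {F' : Set V} (hS : IsComponentOf G F S) (hSF : S ⊆ F') (hF : F' ⊆ F) :
    IsComponentOf G F' S where
  nonempty := hS.nonempty
  subset := hSF
  isClosedIn x hx hxF y hy := hS.isClosedIn x hx (hF hxF) y (hF hy)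
  subset_of_isClosedIn T hT hne := by
    refine (hS.subset_of_isClosedIn (S ∩ T) (fun x hx hxF y hy hxy => ?_) ?_).trans
      Set.inter_subset_right
    · have hyS := hS.isClosedIn x hx.1 hxF y hy hxy
      exact ⟨hyS, hT x hx.2 (hSF hx.1) y (hSF hyS) hxy⟩
    · rwa [← Set.inter_assoc, Set.inter_self]

variable {H : SimpleGraph W} {F S : Set W}

lemma subset_range (hS : IsComponentOf H F S) {f : V → W}
    (hf : ∀ x y, H.Adj (f x) y → y ∈ Set.range f) (hne : (S ∩ Set.range f).Nonempty) :
    S ⊆ Set.range f := by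
  refine hS.subset_of_isClosedIn _ ?_ hne
  rintro _ ⟨x, rfl⟩ - y - hxy
  exact hf x y hxy

lemma preimage (hS : IsComponentOf H F S) (f : G ↪g H)
    (hf : ∀ x y, H.Adj (f x) y → y ∈ Set.range f) (hne : (S ∩ Set.range f).Nonempty) :
    IsComponentOf G (f ⁻¹' F) (f ⁻¹' S) where
  nonempty := by
    obtain ⟨_, hx, x, rfl⟩ := hne
    exact ⟨x, hx⟩
  subset := Set.preimage_mono hS.subset
  isClosedIn x hx hxF y hy hxy := hS.isClosedIn _ hx hxF _ hy (f.map_adj_iff.mpr hxy)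
  subset_of_isClosedIn T hT hne' := by
    have himage : IsClosedIn H F (f '' T) := by
      rintro _ ⟨x, hxT, rfl⟩ hxF y hy hxy
      obtain ⟨z, rfl⟩ := hf x y hxy
      exact ⟨z, hT x hxT hxF z hy (f.map_adj_iff.mp hxy), rfl⟩
    obtain ⟨x, hxS, hxT⟩ := hne'
    have := hS.subset_of_isClosedIn _ himage ⟨f x, hxS, x, hxT, rfl⟩
    rw [← Set.preimage_image_eq T f.injective]
    exact Set.preimage_mono this

end IsComponentOf

section Cycles

variable {F : Set V} {C : G.Walk u u} (hC : C.IsCycle) (hF : {x | x ∈ C.support} ⊆ F)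
  (hdeg : ∀ x ∈ F, (G.neighborSet x ∩ F).encard ≤ 2)
include hC hF hdeg

lemma mem_edges_of_encard_neighborSet_le_two {x y : V} (hx : x ∈ C.support) (hy : y ∈ F)
    (hxy : G.Adj x y) : s(x, y) ∈ C.edges := by
  have hsub : C.toSubgraph.neighborSet x ⊆ G.neighborSet x ∩ F := fun z hz =>
    ⟨hz.adj_sub, hF (Walk.mem_support_of_adj_toSubgraph hz.symm)⟩
  have htwo : (C.toSubgraph.neighborSet x).encard = 2 :=
    Set.encard_eq_two.mpr (Set.ncard_eq_two.mp (hC.ncard_neighborSet_toSubgraph_eq_two hx))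
  have heq := (Set.finite_of_encard_le_coe (hdeg x (hF hx))).eq_of_subset_of_encard_le' hsub
    (htwo ▸ hdeg x (hF hx))
  rw [← Walk.adj_toSubgraph_iff_mem_edges, ← Subgraph.mem_neighborSet, heq]
  exact ⟨hxy, hy⟩

lemma isChordless_of_encard_neighborSet_le_two : C.IsChordless :=
  Walk.isChordless_iff_forall_mem_edges.mpr fun _ _ hx hy hxy =>
    mem_edges_of_encard_neighborSet_le_two hC hF hdeg hx (hF hy) hxy

lemma isComponentOf_of_encard_neighborSet_le_two : IsComponentOf G F {x | x ∈ C.support} where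
  nonempty := ⟨u, C.start_mem_support⟩
  subset := hF
  isClosedIn _ hx _ _ hy hxy :=
    C.snd_mem_support_of_mem_edges (mem_edges_of_encard_neighborSet_le_two hC hF hdeg hx hy hxy)
  subset_of_isClosedIn _ hT hne := support_subset_of_isClosedIn hF hT hne

end Cycles

end Graphs

section Directions

/-- The rotation of the chessboard by a quarter turn counterclockwise about its center. -/
def quarterTurn : Square ≃+ Square where
  toFun x := (-x.2, x.1)
  invFun x := (x.2, -x.1)
  left_inv x := by simp
  right_inv x := by simp
  map_add' x y := by ext <;> simp; abel

@[simp] lemma quarterTurn_fst (x : Square) : (quarterTurn x).1 = -x.2 := rfl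

@[simp] lemma quarterTurn_snd (x : Square) : (quarterTurn x).2 = x.1 := rfl

lemma dirVec_add_two (i : Fin 8) : dirVec (i + 2) = quarterTurn (dirVec i) := by
  fin_cases i <;> rfl

lemma dirVec_fst_eq : ∀ i, (dirVec i).1 = 0 ∨ (dirVec i).1 = 1 ∨ (dirVec i).1 = -1 := by decide

lemma dirVec_snd_eq : ∀ i, (dirVec i).2 = 0 ∨ (dirVec i).2 = 1 ∨ (dirVec i).2 = -1 := by decide

lemma liftVec_add_two (k l : ℤ) (i : Fin 8) :
    liftVec k l (i + 2) = quarterTurn (liftVec k l i) := by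
  have hside : IsSide (i + 2) ↔ IsSide i := by decide +revert
  simp only [liftVec, hside, dirVec_add_two, ← map_zsmul]
  split_ifs <;> rfl

/-- The directions `i - k, …, i + k`. -/
def dirArc (k i : Fin 8) : List (Fin 8) :=
  (List.range (2 * k.val + 1)).map fun j => i - k + Fin.ofNat 8 j

@[elab_as_elim]
lemma direction_induction {P : Fin 8 → Prop} (zero : P 0) (one : P 1)
    (add_two : ∀ i, P i → P (i + 2)) (i : Fin 8) : P i := by
  have two := add_two _ zero
  have three := add_two _ one
  have four := add_two _ two
  have five := add_two _ three
  fin_cases i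
  exacts [zero, one, two, three, four, five, add_two _ four, add_two _ five]

end Directions

section Frames

/-- The `k × k` chessboard centered at the origin, for odd `k`. -/
def centeredBoard (k : ℤ) : Set Square := {x | |2 * x.1| < k ∧ |2 * x.2| < k}

/-- A coordinate `t` of the squares of the `(m, n)`-frame lies in the strip of sign `e`: between the
lines that extend the sides of the hole if `e = 0`, and beyond one of them if `e = ±1`. -/
def InStrip (m n : ℕ) (e t : ℤ) : Prop :=
  if e = 0 then |2 * t| < (n : ℤ) - m
  else (n : ℤ) - m < 2 * (e * t) ∧ 2 * (e * t) < (m : ℤ) + n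

variable {m n : ℕ} {x : Square} {i j : Fin 8}

lemma inStrip_zero {t : ℤ} : InStrip m n 0 t ↔ (m : ℤ) - n < 2 * t ∧ 2 * t < n - m := by
  simp [InStrip, abs_lt, -abs_mul]

lemma inStrip_one {t : ℤ} : InStrip m n 1 t ↔ (n : ℤ) - m < 2 * t ∧ 2 * t < m + n := by
  simp [InStrip]

lemma inStrip_neg_one {t : ℤ} : InStrip m n (-1) t ↔ -(m + n : ℤ) < 2 * t ∧ 2 * t < m - n := by
  rw [InStrip, if_neg (by decide)]
  omega

lemma inStrip_neg_neg {e t : ℤ} : InStrip m n (-e) (-t) ↔ InStrip m n e t := by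
  simp [InStrip]

lemma mem_frameSection : x ∈ frameSection m n i ↔
    InStrip m n (dirVec i).1 x.1 ∧ InStrip m n (dirVec i).2 x.2 := Iff.rfl

lemma mem_centeredBoard {k : ℤ} : x ∈ centeredBoard k ↔
    (-k < 2 * x.1 ∧ 2 * x.1 < k) ∧ (-k < 2 * x.2 ∧ 2 * x.2 < k) := by
  simp only [centeredBoard, Set.mem_ofPred_eq, abs_lt]

lemma frame_eq_diff : frame m n = centeredBoard (m + n) \ centeredBoard (n - m) := rfl

lemma quarterTurn_mem_frameSection :
    quarterTurn x ∈ frameSection m n (i + 2) ↔ x ∈ frameSection m n i := by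
  simp only [mem_frameSection, dirVec_add_two, quarterTurn_fst, quarterTurn_snd, inStrip_neg_neg]
  exact and_comm

lemma quarterTurn_mem_centeredBoard {k : ℤ} :
    quarterTurn x ∈ centeredBoard k ↔ x ∈ centeredBoard k := by
  simp only [centeredBoard, Set.mem_ofPred_eq, quarterTurn_fst, quarterTurn_snd, mul_neg, abs_neg]
  exact and_comm

lemma InStrip.unique {e e' t : ℤ} (hmn : m < n) (he : e = 0 ∨ e = 1 ∨ e = -1)
    (he' : e' = 0 ∨ e' = 1 ∨ e' = -1) (h : InStrip m n e t) (h' : InStrip m n e' t) : e = e' := by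
  rcases he with rfl | rfl | rfl <;> rcases he' with rfl | rfl | rfl <;>
    simp only [inStrip_zero, inStrip_one, inStrip_neg_one] at h h' <;> omega

lemma InStrip.lt {e t : ℤ} (he : e = 0 ∨ e = 1 ∨ e = -1) (h : InStrip m n e t) :
    -(m + n : ℤ) < 2 * t ∧ 2 * t < m + n := by
  rcases he with rfl | rfl | rfl <;>
    simp only [inStrip_zero, inStrip_one, inStrip_neg_one] at h <;> omega

lemma exists_inStrip (hodd : Odd (m + n)) {t : ℤ} (ht : -(m + n : ℤ) < 2 * t ∧ 2 * t < m + n) :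
    ∃ e : ℤ, (e = 0 ∨ e = 1 ∨ e = -1) ∧ InStrip m n e t := by
  by_contra! h
  have h0 := h 0 (by simp)
  have h1 := h 1 (by simp)
  have h2 := h (-1) (by simp)
  simp only [inStrip_zero, inStrip_one, inStrip_neg_one] at h0 h1 h2
  obtain ⟨c, hc⟩ := hodd
  omega

lemma frameSection_disjoint (hmn : m < n) (hi : x ∈ frameSection m n i)
    (hj : x ∈ frameSection m n j) : i = j := by
  have hinj : ∀ i j, dirVec i = dirVec j → i = j := by decide
  exact hinj i j <| Prod.ext
    (InStrip.unique hmn (dirVec_fst_eq i) (dirVec_fst_eq j) hi.1 hj.1)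
    (InStrip.unique hmn (dirVec_snd_eq i) (dirVec_snd_eq j) hi.2 hj.2)

lemma frameSection_subset (hmn : m < n) (i : Fin 8) : frameSection m n i ⊆ frame m n := by
  intro x hx
  refine ⟨mem_centeredBoard.2
    ⟨InStrip.lt (dirVec_fst_eq i) hx.1, InStrip.lt (dirVec_snd_eq i) hx.2⟩, fun hhole => ?_⟩
  have hne : ∀ i, dirVec i ≠ 0 := by decide
  exact hne i <| Prod.ext
    (InStrip.unique hmn (dirVec_fst_eq i) (.inl rfl) hx.1 hhole.1)
    (InStrip.unique hmn (dirVec_snd_eq i) (.inl rfl) hx.2 hhole.2)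

lemma exists_mem_frameSection (hodd : Odd (m + n)) (hx : x ∈ frame m n) :
    ∃ i, x ∈ frameSection m n i := by
  have hx' := mem_centeredBoard.1 hx.1
  obtain ⟨d, hd, hx₁⟩ := exists_inStrip hodd hx'.1
  obtain ⟨e, he, hx₂⟩ := exists_inStrip hodd hx'.2
  have hdir : d = 0 ∧ e = 0 ∨ ∃ i, dirVec i = (d, e) := by
    rcases hd with rfl | rfl | rfl <;> rcases he with rfl | rfl | rfl <;> decide
  rcases hdir with ⟨rfl, rfl⟩ | ⟨i, hi⟩
  · exact absurd ⟨hx₁, hx₂⟩ hx.2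
  · exact ⟨i, by rw [mem_frameSection, hi]; exact ⟨hx₁, hx₂⟩⟩

end Frames

section Moves

variable {m n : ℕ} {x y : Square} {k : Fin 8}

/-- The move of an `(m, n)`-leaper that takes sections `i` and `i + 1` of the `(m, n)`-frame onto
sections `i + 4` and `i + 5`. -/
def sectionMove (m n : ℕ) : Fin 8 → Square :=
  ![(-n, -m), (-m, -n), (m, -n), (n, -m), (n, m), (m, n), (-m, n), (-n, m)]

lemma sectionMove_add_two (m n : ℕ) (i : Fin 8) :
    sectionMove m n (i + 2) = quarterTurn (sectionMove m n i) := by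
  fin_cases i <;> simp [sectionMove, Prod.ext_iff]

lemma leaperGraph_adj_quarterTurn :
    (leaperGraph m n).Adj (quarterTurn x) (quarterTurn y) ↔ (leaperGraph m n).Adj x y := by
  simp only [leaperGraph, ne_eq, EmbeddingLike.apply_eq_iff_eq, quarterTurn_fst, quarterTurn_snd]
  grind

lemma leaperGraph_adj_add_right {z : Square} :
    (leaperGraph m n).Adj (x + z) (y + z) ↔ (leaperGraph m n).Adj x y := by
  simp only [leaperGraph, ne_eq, add_left_inj, Prod.fst_add, Prod.snd_add, add_sub_add_right_eq_sub]

lemma leaperGraph_adj_sectionMove (hn : 0 < n) (x : Square) (i : Fin 8) :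
    (leaperGraph m n).Adj x (x + sectionMove m n i) := by
  have hne : sectionMove m n i ≠ 0 := by
    fin_cases i <;> simp only [sectionMove, Fin.reduceFinMk, Matrix.cons_val, ne_eq,
      Prod.ext_iff, Prod.fst_zero, Prod.snd_zero] <;> omega
  refine ⟨by simpa [eq_comm] using hne, ?_⟩
  simp only [Prod.fst_add, Prod.snd_add, add_sub_cancel_left]
  fin_cases i <;> simp [sectionMove]

lemma add_sectionMove_mem (hmn : m < n) (hodd : Odd (m + n))
    (hx : x ∈ frameSection m n k ∨ x ∈ frameSection m n (k + 1)) :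
    x + sectionMove m n k ∈ frameSection m n (k + 4) ∨
      x + sectionMove m n k ∈ frameSection m n (k + 5) := by
  obtain ⟨c, hc⟩ := hodd
  induction k using direction_induction generalizing x with
  | add_two k ih =>
    obtain ⟨x, rfl⟩ := quarterTurn.surjective x
    rw [add_right_comm k 2 1, quarterTurn_mem_frameSection, quarterTurn_mem_frameSection] at hx
    rw [sectionMove_add_two, ← map_add, add_right_comm k 2 4, add_right_comm k 2 5]
    simpa only [quarterTurn_mem_frameSection] using ih hx
  | _ =>
    simp only [sectionMove, mem_frameSection, dirVec, Matrix.cons_val, inStrip_zero, inStrip_one,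
      inStrip_neg_one, Prod.fst_add, Prod.snd_add, zero_add, Fin.reduceAdd] at hx ⊢
    omega

lemma eq_add_sectionMove (hmn : m < n) (hx : x ∈ frameSection m n k)
    (hy : y ∈ centeredBoard (m + n)) (hxy : (leaperGraph m n).Adj x y) :
    y = x + sectionMove m n k ∨ y = x + sectionMove m n (k + 7) := by
  induction k using direction_induction generalizing x y with
  | add_two k ih =>
    obtain ⟨x, rfl⟩ := quarterTurn.surjective x
    obtain ⟨y, rfl⟩ := quarterTurn.surjective y
    rw [quarterTurn_mem_frameSection] at hx
    rw [quarterTurn_mem_centeredBoard] at hy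
    rw [leaperGraph_adj_quarterTurn] at hxy
    rw [add_right_comm k 2 7, sectionMove_add_two, sectionMove_add_two, ← map_add, ← map_add]
    simpa only [EmbeddingLike.apply_eq_iff_eq] using ih hx hy hxy
  | _ =>
    obtain ⟨-, hxy⟩ := hxy
    simp only [sectionMove, mem_frameSection, mem_centeredBoard, dirVec, Matrix.cons_val,
      inStrip_zero, inStrip_one, Prod.ext_iff, Prod.fst_add, Prod.snd_add,
      zero_add, Fin.reduceAdd] at hx hy ⊢
    omega

lemma mem_frame_of_adj (hx : x ∈ centeredBoard (m + n)) (hy : y ∈ centeredBoard (m + n))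
    (hxy : (leaperGraph m n).Adj x y) : x ∈ frame m n := by
  refine ⟨hx, fun hhole => ?_⟩
  obtain ⟨-, h⟩ := hxy
  have := mem_centeredBoard.1 hhole
  rw [mem_centeredBoard] at hx hy
  omega

end Moves

section Liftings

/-- The lifting with translations `v` of the `(m, n)`-frame to the `(m', n')`-frame is one of `f`,
`g` and `h`. The sections of the lifted frame in the directions `i` of parity `t` receive copies of
the sections `i - e, …, i + e`, and all others receive copies of the opposite sections
`i + 3 - e, …, i + 5 + e`. -/
structure IsLifting (m n m' n' : ℕ) (v : Fin 8 → Square) (t : Fin 2) (e : Fin 8) : Prop where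
  lt : m < n
  odd : Odd (m + n)
  vec_eq : v = liftVec (n' - m') m'
  type : (m' = m ∧ n' = 2 * m + n ∧ t = 1 ∧ e = 0) ∨ (m' = n ∧ n' + m = 2 * n ∧ t = 0 ∧ e = 0) ∨
    (m' = n ∧ n' = m + 2 * n ∧ t = 1 ∧ e = 1)

lemma isLifting_f {m n : ℕ} (hmn : m < n) (hodd : Odd (m + n)) :
    IsLifting m n m (2 * m + n) (fVec m n) 1 0 where
  lt := hmn
  odd := hodd
  vec_eq := by rw [fVec]; congr 1; push_cast; ring
  type := .inl ⟨rfl, rfl, rfl, rfl⟩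

lemma isLifting_g {m n : ℕ} (hmn : m < n) (hodd : Odd (m + n)) :
    IsLifting m n n (2 * n - m) (gVec m n) 0 0 where
  lt := hmn
  odd := hodd
  vec_eq := by rw [gVec]; congr 1; omega
  type := .inr (.inl ⟨rfl, by omega, rfl, rfl⟩)

lemma isLifting_h {m n : ℕ} (hmn : m < n) (hodd : Odd (m + n)) :
    IsLifting m n n (m + 2 * n) (hVec m n) 1 1 where
  lt := hmn
  odd := hodd
  vec_eq := by rw [hVec]; congr 1; push_cast; ring
  type := .inr (.inr ⟨rfl, rfl, rfl, rfl⟩)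

/-- The directions of the sections of an `(m, n)`-frame that are copied to the section in direction
`i` of the lifted frame. -/
def sources (t : Fin 2) (e i : Fin 8) : List (Fin 8) :=
  if i.val % 2 = t then dirArc e i else dirArc (1 + e) (i + 4)

lemma add_two_val_mod_two : ∀ i : Fin 8, (i + 2).val % 2 = i.val % 2 := by decide

lemma add_two_mem_dirArc {j i k : Fin 8} : k + 2 ∈ dirArc j (i + 2) ↔ k ∈ dirArc j i := by
  decide +revert

lemma mem_sources_add_two {t : Fin 2} {e i k : Fin 8} :
    k + 2 ∈ sources t e (i + 2) ↔ k ∈ sources t e i := by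
  simp only [sources, add_two_val_mod_two, add_right_comm i 2 4]
  split_ifs <;> exact add_two_mem_dirArc

namespace IsLifting

variable {m n m' n' : ℕ} {v : Fin 8 → Square} {t : Fin 2} {e : Fin 8} {i k : Fin 8} {x y : Square}

lemma extent (hl : IsLifting m n m' n' v t e) : e = 0 ∨ e = 1 := by
  obtain ⟨-, -, -, h⟩ | ⟨-, -, -, h⟩ | ⟨-, -, -, h⟩ := hl.type <;> simp [h]

lemma le' (hl : IsLifting m n m' n' v t e) : m ≤ m' := by
  have := hl.lt
  rcases hl.type with h | h | h <;> omega

lemma lt' (hl : IsLifting m n m' n' v t e) : m' < n' := by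
  have := hl.lt
  rcases hl.type with h | h | h <;> omega

lemma odd' (hl : IsLifting m n m' n' v t e) : Odd (m' + n') := by
  obtain ⟨c, hc⟩ := hl.odd
  have := hl.lt
  rcases hl.type with h | h | h
  · exact ⟨c + m, by omega⟩
  · exact ⟨c + n - m, by omega⟩
  · exact ⟨c + n, by omega⟩

lemma vec_add_two (hl : IsLifting m n m' n' v t e) (i : Fin 8) :
    v (i + 2) = quarterTurn (v i) := by
  rw [hl.vec_eq, liftVec_add_two]

lemma vec_zero (hl : IsLifting m n m' n' v t e) : v 0 = ((n' : ℤ) - m', 0) := by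
  simp [hl.vec_eq, liftVec, IsSide, dirVec]

lemma vec_one (hl : IsLifting m n m' n' v t e) : v 1 = ((m' : ℤ), (m' : ℤ)) := by
  simp [hl.vec_eq, liftVec, IsSide, dirVec]

lemma vec_two (hl : IsLifting m n m' n' v t e) : v 2 = (0, (n' : ℤ) - m') := by
  simp [hl.vec_eq, liftVec, IsSide, dirVec]

lemma vec_seven (hl : IsLifting m n m' n' v t e) : v 7 = ((m' : ℤ), -(m' : ℤ)) := by
  simp [hl.vec_eq, liftVec, IsSide, dirVec]

lemma vec_add_sectionMove (hl : IsLifting m n m' n' v t e) (i : Fin 8) :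
    v i + sectionMove m' n' i = v (i + 5) := by
  rw [hl.vec_eq]
  fin_cases i <;> ext <;> simp [liftVec, IsSide, dirVec, sectionMove] <;> ring

lemma vec_add_one_add_sectionMove (hl : IsLifting m n m' n' v t e) (i : Fin 8) :
    v (i + 1) + sectionMove m' n' i = v (i + 4) := by
  rw [hl.vec_eq]
  fin_cases i <;> ext <;> simp [liftVec, IsSide, dirVec, sectionMove] <;> ring

lemma vec_add_one_add_sectionMove_source (hl : IsLifting m n m' n' v t e) (hi : i.val % 2 = t) :
    v (i + 1) + sectionMove m n (i + 1 + e) = v i := by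
  induction i using direction_induction with
  | add_two i ih =>
    rw [add_two_val_mod_two] at hi
    rw [add_right_comm i 2 1, add_right_comm (i + 1) 2 e, hl.vec_add_two, sectionMove_add_two,
      ← map_add, ih hi, hl.vec_add_two]
  | _ =>
    rcases hl.type with ⟨rfl, rfl, rfl, rfl⟩ | ⟨rfl, h, rfl, rfl⟩ | ⟨rfl, rfl, rfl, rfl⟩ <;>
      first
      | exact absurd hi (by decide)
      | simp only [Fin.reduceAdd, zero_add, hl.vec_zero, hl.vec_one, hl.vec_two, sectionMove,
          Matrix.cons_val, Prod.ext_iff, Prod.fst_add, Prod.snd_add, true_and]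
        omega

lemma vec_sub_one_add_sectionMove_source (hl : IsLifting m n m' n' v t e) (hi : i.val % 2 = t) :
    v (i - 1) + sectionMove m n (i - 2 - e) = v i := by
  induction i using direction_induction with
  | add_two i ih =>
    rw [add_two_val_mod_two] at hi
    rw [add_sub_right_comm i 2 1, add_sub_right_comm i 2 2, add_sub_right_comm (i - 2) 2 e,
      hl.vec_add_two, sectionMove_add_two, ← map_add, ih hi, hl.vec_add_two]
  | _ =>
    rcases hl.type with ⟨rfl, rfl, rfl, rfl⟩ | ⟨rfl, h, rfl, rfl⟩ | ⟨rfl, rfl, rfl, rfl⟩ <;>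
      first
      | exact absurd hi (by decide)
      | simp only [Fin.reduceSub, hl.vec_zero, hl.vec_one, hl.vec_seven, sectionMove,
          Matrix.cons_val, Prod.ext_iff, Prod.fst_add, Prod.snd_add]
        omega

lemma mem_frameSection_add_vec_iff (hl : IsLifting m n m' n' v t e) (hx : x ∈ frameSection m n k) :
    x + v i ∈ frameSection m' n' i ↔ k ∈ sources t e i := by
  have := hl.lt
  induction i using direction_induction generalizing x k with
  | add_two i ih =>
    obtain ⟨x, rfl⟩ := quarterTurn.surjective x
    obtain ⟨k, rfl⟩ := (Equiv.addRight (2 : Fin 8)).surjective k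
    rw [Equiv.coe_addRight, quarterTurn_mem_frameSection] at hx
    rw [hl.vec_add_two, ← map_add, quarterTurn_mem_frameSection, Equiv.coe_addRight,
      mem_sources_add_two]
    exact ih hx
  | _ =>
    rcases hl.type with ⟨rfl, rfl, rfl, rfl⟩ | ⟨rfl, h, rfl, rfl⟩ | ⟨rfl, rfl, rfl, rfl⟩
    all_goals
      fin_cases k <;>
        simp +decide only [mem_frameSection, dirVec, Fin.reduceFinMk, Matrix.cons_val, inStrip_zero,
          inStrip_one, inStrip_neg_one, hl.vec_zero, hl.vec_one, Prod.fst_add, Prod.snd_add,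
          iff_true, iff_false] at hx ⊢ <;>
        omega

lemma sub_vec_mem_centeredBoard (hl : IsLifting m n m' n' v t e) (hx : x ∈ frameSection m' n' i) :
    x - v i ∈ centeredBoard (m + n) := by
  have := hl.lt
  induction i using direction_induction generalizing x with
  | add_two i ih =>
    obtain ⟨x, rfl⟩ := quarterTurn.surjective x
    rw [quarterTurn_mem_frameSection] at hx
    rw [hl.vec_add_two, ← map_sub, quarterTurn_mem_centeredBoard]
    exact ih hx
  | _ =>
    simp only [mem_frameSection, dirVec, Matrix.cons_val, inStrip_zero, inStrip_one] at hx
    simp only [mem_centeredBoard, hl.vec_zero, hl.vec_one, Prod.fst_sub, Prod.snd_sub]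
    rcases hl.type with h | h | h <;> omega

lemma add_vec_add_one_sub_notMem (hl : IsLifting m n m' n' v t e) (hi : i.val % 2 = t)
    (hk : k ∈ dirArc e (i + 4)) (hx : x ∈ frameSection m n k)
    (hy : y ∈ frameSection m' n' i ∨ y ∈ frameSection m' n' (i - 1)) :
    x + v (i + 1) - y ∉ centeredBoard (2 * m + 1) := by
  have := hl.lt
  induction i using direction_induction generalizing x y k with
  | add_two i ih =>
    obtain ⟨x, rfl⟩ := quarterTurn.surjective x
    obtain ⟨y, rfl⟩ := quarterTurn.surjective y
    obtain ⟨k, rfl⟩ : ∃ k', k = k' + 2 := ⟨k - 2, (sub_add_cancel k 2).symm⟩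
    rw [add_two_val_mod_two] at hi
    rw [add_right_comm i 2 4, add_two_mem_dirArc] at hk
    rw [add_sub_right_comm i 2 1] at hy
    rw [quarterTurn_mem_frameSection] at hx
    rw [quarterTurn_mem_frameSection, quarterTurn_mem_frameSection] at hy
    rw [add_right_comm i 2 1, hl.vec_add_two, ← map_add, ← map_sub, quarterTurn_mem_centeredBoard]
    exact ih hi hk hx hy
  | _ =>
    rcases hl.type with ⟨rfl, rfl, rfl, rfl⟩ | ⟨rfl, h, rfl, rfl⟩ | ⟨rfl, rfl, rfl, rfl⟩
    all_goals
      first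
      | exact absurd hi (by decide)
      | fin_cases k <;>
          simp +decide only [mem_frameSection, mem_centeredBoard, dirVec, Fin.reduceFinMk,
            Matrix.cons_val, inStrip_zero, inStrip_one, inStrip_neg_one, hl.vec_one, hl.vec_two,
            Prod.fst_add, Prod.snd_add, Prod.fst_sub, Prod.snd_sub, zero_add, Fin.reduceAdd,
            Fin.reduceSub] at hk hx hy ⊢ <;>
          omega

lemma add_vec_sub_one_sub_notMem (hl : IsLifting m n m' n' v t e) (hi : i.val % 2 = t)
    (hk : k ∈ dirArc e (i + 4)) (hx : x ∈ frameSection m n k)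
    (hy : y ∈ frameSection m' n' i ∨ y ∈ frameSection m' n' (i + 1)) :
    x + v (i - 1) - y ∉ centeredBoard (2 * m + 1) := by
  have := hl.lt
  induction i using direction_induction generalizing x y k with
  | add_two i ih =>
    obtain ⟨x, rfl⟩ := quarterTurn.surjective x
    obtain ⟨y, rfl⟩ := quarterTurn.surjective y
    obtain ⟨k, rfl⟩ : ∃ k', k = k' + 2 := ⟨k - 2, (sub_add_cancel k 2).symm⟩
    rw [add_two_val_mod_two] at hi
    rw [add_right_comm i 2 4, add_two_mem_dirArc] at hk
    rw [add_right_comm i 2 1] at hy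
    rw [quarterTurn_mem_frameSection] at hx
    rw [quarterTurn_mem_frameSection, quarterTurn_mem_frameSection] at hy
    rw [add_sub_right_comm i 2 1, hl.vec_add_two, ← map_add, ← map_sub,
      quarterTurn_mem_centeredBoard]
    exact ih hi hk hx hy
  | _ =>
    rcases hl.type with ⟨rfl, rfl, rfl, rfl⟩ | ⟨rfl, h, rfl, rfl⟩ | ⟨rfl, rfl, rfl, rfl⟩
    all_goals
      first
      | exact absurd hi (by decide)
      | fin_cases k <;>
          simp +decide only [mem_frameSection, mem_centeredBoard, dirVec, Fin.reduceFinMk,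
            Matrix.cons_val, inStrip_zero, inStrip_one, inStrip_neg_one, hl.vec_zero, hl.vec_seven,
            Prod.fst_add, Prod.snd_add, Prod.fst_sub, Prod.snd_sub, zero_add, Fin.reduceAdd,
            Fin.reduceSub] at hk hx hy ⊢ <;>
          omega

lemma add_vec_sub_notMem (hl : IsLifting m n m' n' v t e) (hi : i.val % 2 = t)
    (hk : k ∈ dirArc e i) (hx : x ∈ frameSection m n k)
    (hy : y ∈ frameSection m' n' (i + 2)) :
    x + v i - y ∉ centeredBoard (2 * (n' - m') + 1) := by
  have := hl.lt
  induction i using direction_induction generalizing x y k with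
  | add_two i ih =>
    obtain ⟨x, rfl⟩ := quarterTurn.surjective x
    obtain ⟨y, rfl⟩ := quarterTurn.surjective y
    obtain ⟨k, rfl⟩ : ∃ k', k = k' + 2 := ⟨k - 2, (sub_add_cancel k 2).symm⟩
    rw [add_two_val_mod_two] at hi
    rw [add_two_mem_dirArc] at hk
    rw [quarterTurn_mem_frameSection] at hx hy
    rw [hl.vec_add_two, ← map_add, ← map_sub, quarterTurn_mem_centeredBoard]
    exact ih hi hk hx hy
  | _ =>
    rcases hl.type with ⟨rfl, rfl, rfl, rfl⟩ | ⟨rfl, h, rfl, rfl⟩ | ⟨rfl, rfl, rfl, rfl⟩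
    all_goals
      first
      | exact absurd hi (by decide)
      | fin_cases k <;>
          simp +decide only [mem_frameSection, mem_centeredBoard, dirVec, Fin.reduceFinMk,
            Matrix.cons_val, inStrip_zero, inStrip_one, inStrip_neg_one, hl.vec_zero, hl.vec_one,
            Prod.fst_add, Prod.snd_add, Prod.fst_sub, Prod.snd_sub, zero_add, Fin.reduceAdd]
            at hk hx hy ⊢ <;>
          omega

end IsLifting

end Liftings

section Infix

variable {α : Type*} {x y : α} {A B C : List α}

lemma pair_infix_of_append_left (h : [x, y] <:+: A ++ B) (hx : x ∉ B) (hy : y ∉ B) :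
    [x, y] <:+: A := by
  rcases List.infix_append_iff.1 h with h | h | ⟨l₁, l₂, h, h₁, h₂⟩
  · exact h
  · exact absurd (h.subset List.mem_cons_self) hx
  · obtain rfl | ⟨l, z, rfl⟩ := List.eq_nil_or_concat l₂
    · rw [h, List.append_nil]
      exact h₁.isInfix
    · obtain rfl : y = z := by simpa using congrArg List.getLast? h
      exact absurd (h₂.subset (by simp)) hy

lemma pair_infix_reverse : [x, y] <:+: A.reverse ↔ [y, x] <:+: A := by
  rw [← List.reverse_infix, List.reverse_reverse]
  rfl

lemma pair_infix_of_append_right (h : [x, y] <:+: A ++ B) (hx : x ∉ A) (hy : y ∉ A) :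
    [x, y] <:+: B := by
  rw [← pair_infix_reverse, List.reverse_append] at h
  exact pair_infix_reverse.1
    (pair_infix_of_append_left h (List.mem_reverse.not.2 hy) (List.mem_reverse.not.2 hx))

lemma pair_infix_append_append (hB : B ≠ []) (h : [x, y] <:+: A ++ B ++ C) :
    [x, y] <:+: A ++ B ∨ [x, y] <:+: B ++ C := by
  rw [List.append_assoc, List.infix_append_iff_ne_nil] at h
  rcases h with h | h | ⟨l₁, l₂, hl₁, hl₂, h, h₁, h₂⟩
  · exact .inl (h.trans (List.infix_append' [] A B))
  · exact .inr h
  · obtain ⟨b, B, rfl⟩ := List.exists_cons_of_ne_nil hB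
    obtain ⟨rfl, rfl⟩ : l₁ = [x] ∧ l₂ = [y] := by
      match l₁, l₂ with
      | [_], [_] => simpa [eq_comm] using h
      | [], _ | _, [] => contradiction
      | _ :: _ :: _, _ :: _ | [_], _ :: _ :: _ => simp at h
    obtain ⟨A, rfl⟩ := h₁
    obtain ⟨rfl, -⟩ := List.cons_prefix_cons.1 h₂
    exact .inl ⟨A, B, by simp⟩

end Infix

section Arcs

lemma dirArc_zero (i : Fin 8) : dirArc 0 i = [i] := by
  decide +revert

lemma dirArc_one (i : Fin 8) : dirArc 1 i = [i + 7, i, i + 1] := by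
  decide +revert

lemma dirArc_two (i : Fin 8) : dirArc 2 i = [i + 6, i + 7, i, i + 1, i + 2] := by
  decide +revert

lemma dirArc_one_add_add_one {e : Fin 8} (he : e = 0 ∨ e = 1) (i : Fin 8) :
    dirArc (1 + e) (i + 1) = dirArc e i ++ [i + 1 + e, i + 1 + e + 1] := by
  decide +revert

lemma dirArc_one_add_sub_one {e : Fin 8} (he : e = 0 ∨ e = 1) (i : Fin 8) :
    dirArc (1 + e) (i - 1) = [i - 2 - e, i - 2 - e + 1] ++ dirArc e i := by
  decide +revert

lemma dirArc_two_add {e : Fin 8} (he : e = 0 ∨ e = 1) (i : Fin 8) :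
    dirArc (2 + e) i = [i - 2 - e, i - 2 - e + 1] ++ dirArc e i ++ [i + 1 + e, i + 1 + e + 1] := by
  decide +revert

lemma dirArc_ne_nil : ∀ k i, dirArc k i ≠ [] := by
  decide

lemma isChain_dirArc : ∀ k i, (dirArc k i).IsChain fun j j' => j' = j + 1 := by
  decide

lemma nodup_dirArc : ∀ k ≤ 3, ∀ i, (dirArc k i).Nodup := by
  decide

lemma pair_infix_dirArc : ∀ k ≤ 3, ∀ i j,
    j ∈ dirArc k i → j + 1 ∈ dirArc k i → [j, j + 1] <:+: dirArc k i := by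
  decide

namespace SectionPaths

variable {a : SectionPaths} {i j k : Fin 8} {x y : Square}

/-- The concatenation of the paths in the sections `i - k, …, i + k`. -/
def arc (a : SectionPaths) (k i : Fin 8) : List Square := (dirArc k i).flatMap a

lemma mem_arc : x ∈ a.arc k i ↔ ∃ j ∈ dirArc k i, x ∈ a j := List.mem_flatMap

lemma arc_ne_nil (hne : ∀ i, a i ≠ []) : a.arc k i ≠ [] := by
  obtain ⟨j, hj⟩ := List.exists_mem_of_ne_nil _ (dirArc_ne_nil k i)
  obtain ⟨x, hx⟩ := List.exists_mem_of_ne_nil _ (hne j)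
  exact List.ne_nil_of_mem (mem_arc.2 ⟨j, hj, hx⟩)

lemma isChain_flatMap {R : Square → Square → Prop} (hne : ∀ i, a i ≠ [])
    (h : ∀ i, (a i ++ a (i + 1)).IsChain R) :
    ∀ {l : List (Fin 8)}, l.IsChain (fun j j' => j' = j + 1) → (l.flatMap a).IsChain R
  | [], _ => .nil
  | [j], _ => by simpa using (h j).left_of_append
  | j :: j' :: l, hl => by
    obtain ⟨rfl, hl⟩ := List.isChain_cons_cons.1 hl
    have := isChain_flatMap hne h hl
    rw [List.flatMap_cons] at this
    rw [List.flatMap_cons, List.flatMap_cons, ← List.append_assoc]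
    exact (h j).append_overlap this (hne _)

lemma isChain_arc {R : Square → Square → Prop} (hne : ∀ i, a i ≠ [])
    (h : ∀ i, (a i ++ a (i + 1)).IsChain R) (k i : Fin 8) : (a.arc k i).IsChain R :=
  isChain_flatMap hne h (isChain_dirArc k i)

lemma nodup_arc (h : ∀ i, (a i).Nodup) (hd : ∀ i j x, x ∈ a i → x ∈ a j → i = j) (hk : k ≤ 3)
    (i : Fin 8) : (a.arc k i).Nodup :=
  List.nodup_flatMap.2 ⟨fun j _ => h j,
    (nodup_dirArc k hk i).imp fun hj x hx hx' => hj (hd _ _ x hx hx')⟩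

lemma pair_infix_arc (hd : ∀ i j x, x ∈ a i → x ∈ a j → i = j) (hk : k ≤ 3)
    (hx : x ∈ a.arc k i) (hy : y ∈ a.arc k i) (h : [x, y] <:+: a j ++ a (j + 1)) :
    [x, y] <:+: a.arc k i := by
  have infix_arc : ∀ l ∈ dirArc k i, a l <:+: a.arc k i := fun l hl => by
    simpa [arc] using ((List.singleton_infix_iff l (dirArc k i)).2 hl).flatMap a
  have notMem : ∀ l ∉ dirArc k i, ∀ z ∈ a.arc k i, z ∉ a l := by
    intro l hl z hz hzl
    obtain ⟨l', hl', hz'⟩ := mem_arc.1 hz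
    exact hl (hd l l' z hzl hz' ▸ hl')
  by_cases hj : j ∈ dirArc k i
  · by_cases hj' : j + 1 ∈ dirArc k i
    · exact h.trans (by simpa [arc] using (pair_infix_dirArc k hk i j hj hj').flatMap a)
    · exact (pair_infix_of_append_left h (notMem _ hj' _ hx) (notMem _ hj' _ hy)).trans
        (infix_arc _ hj)
  · have h' := pair_infix_of_append_right h (notMem _ hj _ hx) (notMem _ hj _ hy)
    by_cases hj' : j + 1 ∈ dirArc k i
    · exact h'.trans (infix_arc _ hj')
    · exact absurd (h'.subset List.mem_cons_self) (notMem _ hj' _ hx)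

/-- Two squares are linked if they are consecutive, in either order, on a path through two adjacent
sections. -/
def Linked (a : SectionPaths) (x y : Square) : Prop :=
  ∃ i, [x, y] <:+: a i ++ a (i + 1) ∨ [y, x] <:+: a i ++ a (i + 1)

lemma Linked.symm (h : a.Linked x y) : a.Linked y x := h.imp fun _ => Or.symm

end SectionPaths

end Arcs

section ShiftPath

variable {v w x : Square} {A B : List Square}

lemma shiftPath_append : shiftPath v (A ++ B) = shiftPath v A ++ shiftPath v B := List.map_append

lemma shiftPath_reverse : shiftPath v A.reverse = (shiftPath v A).reverse := List.map_reverse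

lemma shiftPath_shiftPath : shiftPath v (shiftPath w A) = shiftPath (w + v) A := by
  simp only [shiftPath, List.map_map, Function.comp_def, add_assoc]

lemma mem_shiftPath : x ∈ shiftPath v A ↔ x - v ∈ A := by
  simp [shiftPath, ← eq_sub_iff_add_eq]

lemma isChain_shiftPath {r s : ℕ} (h : A.IsChain (leaperGraph r s).Adj) :
    (shiftPath v A).IsChain (leaperGraph r s).Adj :=
  (List.isChain_map _).2 (h.imp fun _ _ => leaperGraph_adj_add_right.2)

lemma isChain_reverse {V : Type*} {G : SimpleGraph V} {A : List V} (h : A.IsChain G.Adj) :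
    A.reverse.IsChain G.Adj :=
  List.isChain_reverse.2 (h.imp fun _ _ => SimpleGraph.Adj.symm)

end ShiftPath

section LiftPaths

/-- The effect of a lifting on a cycle, with `v`, `t` and `e` as in `IsLifting`. -/
def liftPaths (v : Fin 8 → Square) (t : Fin 2) (e : Fin 8) (a : SectionPaths) : SectionPaths :=
  fun i => shiftPath (v i) (if i.val % 2 = t then a.arc e i else (a.arc (1 + e) (i + 4)).reverse)

lemma fPaths_eq (m n : ℕ) (a : SectionPaths) : fPaths m n a = liftPaths (fVec m n) 1 0 a := by
  funext i
  by_cases hi : i.val % 2 = 0 <;>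
    simp [fPaths, liftPaths, IsSide, SectionPaths.arc, dirArc_zero, dirArc_one, add_assoc, hi,
      Nat.mod_two_ne_zero.1]

lemma gPaths_eq (m n : ℕ) (a : SectionPaths) : gPaths m n a = liftPaths (gVec m n) 0 0 a := by
  funext i
  by_cases hi : i.val % 2 = 0 <;>
    simp [gPaths, liftPaths, IsSide, SectionPaths.arc, dirArc_zero, dirArc_one, add_assoc, hi]

lemma hPaths_eq (m n : ℕ) (a : SectionPaths) : hPaths m n a = liftPaths (hVec m n) 1 1 a := by
  funext i
  by_cases hi : i.val % 2 = 0 <;>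
    simp [hPaths, liftPaths, IsSide, SectionPaths.arc, dirArc_one, dirArc_two, add_assoc, hi,
      Nat.mod_two_ne_zero.1]

variable {v : Fin 8 → Square} {t : Fin 2} {e i : Fin 8} {a : SectionPaths} {x : Square}

lemma add_one_val_mod_two_ne : (i + 1).val % 2 ≠ t ↔ i.val % 2 = t := by
  decide +revert

lemma sub_one_val_mod_two_ne : (i - 1).val % 2 ≠ t ↔ i.val % 2 = t := by
  decide +revert

lemma add_four_val_mod_two : (i + 4).val % 2 = i.val % 2 := by
  decide +revert

lemma liftPaths_of_eq (hi : i.val % 2 = t) :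
    liftPaths v t e a i = shiftPath (v i) (a.arc e i) := by
  rw [liftPaths, if_pos hi]

lemma liftPaths_of_ne (hi : i.val % 2 ≠ t) :
    liftPaths v t e a i = (shiftPath (v i) (a.arc (1 + e) (i + 4))).reverse := by
  rw [liftPaths, if_neg hi, shiftPath_reverse]

lemma mem_liftPaths : x ∈ liftPaths v t e a i ↔ ∃ k ∈ sources t e i, x - v i ∈ a k := by
  rw [sources]
  by_cases hi : i.val % 2 = t
  · rw [liftPaths_of_eq hi, if_pos hi, mem_shiftPath, SectionPaths.mem_arc]
  · rw [liftPaths_of_ne hi, if_neg hi, List.mem_reverse, mem_shiftPath, SectionPaths.mem_arc]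

lemma liftPaths_ne_nil (hne : ∀ i, a i ≠ []) (i : Fin 8) : liftPaths v t e a i ≠ [] := by
  rw [liftPaths, shiftPath, Ne, List.map_eq_nil_iff]
  split_ifs
  · exact SectionPaths.arc_ne_nil hne
  · exact List.reverse_eq_nil_iff.not.2 (SectionPaths.arc_ne_nil hne)

end LiftPaths

/-- `IsSecondTour p q S r s a`: the concatenation of the paths `a` is a tour of the set `S` of
squares of the `(p, q)`-frame by an `(r, s)`-leaper without further moves between squares of `S`,
and every move of a `(p, q)`-leaper between opposite pairs of adjacent sections reverses it. The
last condition is what makes the pieces of a lifted tour fit together. -/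
structure IsSecondTour (p q : ℕ) (S : Set Square) (r s : ℕ) (a : SectionPaths) : Prop where
  lt : p < q
  odd : Odd (p + q)
  odd' : Odd (r + s)
  lt' : r < s
  le : s ≤ p
  mem_section : ∀ i, ∀ x ∈ a i, x ∈ frameSection p q i
  mem_iff : ∀ x, x ∈ S ↔ ∃ i, x ∈ a i
  ne_nil : ∀ i, a i ≠ []
  nodup : ∀ i, (a i).Nodup
  move : ∀ i, shiftPath (sectionMove p q i) (a i ++ a (i + 1)) = (a (i + 4) ++ a (i + 5)).reverse
  chain : ∀ i, (a i ++ a (i + 1)).IsChain (leaperGraph r s).Adj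
  linked : ∀ x ∈ S, ∀ y ∈ S, (leaperGraph r s).Adj x y → a.Linked x y

lemma IsSecondTour.disjoint {p q : ℕ} {S : Set Square} {r s : ℕ} {a : SectionPaths}
    (h : IsSecondTour p q S r s a) (i j : Fin 8) (x : Square) (hi : x ∈ a i) (hj : x ∈ a j) :
    i = j :=
  frameSection_disjoint h.lt (h.mem_section i x hi) (h.mem_section j x hj)

section LiftTours

variable {m n m' n' : ℕ} {v : Fin 8 → Square} {t : Fin 2} {e i : Fin 8} {S : Set Square}
  {r s : ℕ} {a : SectionPaths}

lemma liftPaths_add_one (h : IsSecondTour m n S r s a) (hl : IsLifting m n m' n' v t e)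
    (hi : i.val % 2 = t) :
    liftPaths v t e a (i + 1) = shiftPath (v i) (a (i + 1 + e) ++ a (i + 1 + e + 1)) ++
      (shiftPath (v (i + 1)) (a.arc e (i + 4))).reverse := by
  have opposite : a.arc (1 + e) (i + 4 + 1) =
      a.arc e (i + 4) ++ (a (i + 1 + e + 4) ++ a (i + 1 + e + 5)) := by
    rw [SectionPaths.arc, dirArc_one_add_add_one hl.extent, List.flatMap_append,
      show i + 4 + 1 + e = i + 1 + e + 4 by grind]
    simp [SectionPaths.arc, add_assoc]
  rw [liftPaths_of_ne (add_one_val_mod_two_ne.2 hi), add_right_comm i 1 4, opposite,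
    shiftPath_append, List.reverse_append, ← shiftPath_reverse, ← h.move, shiftPath_shiftPath,
    add_comm (sectionMove _ _ _), hl.vec_add_one_add_sectionMove_source hi]

lemma liftPaths_sub_one (h : IsSecondTour m n S r s a) (hl : IsLifting m n m' n' v t e)
    (hi : i.val % 2 = t) :
    liftPaths v t e a (i - 1) = (shiftPath (v (i - 1)) (a.arc e (i + 4))).reverse ++
      shiftPath (v i) (a (i - 2 - e) ++ a (i - 2 - e + 1)) := by
  have opposite : a.arc (1 + e) (i + 4 - 1) =
      (a (i - 2 - e + 4) ++ a (i - 2 - e + 5)) ++ a.arc e (i + 4) := by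
    rw [SectionPaths.arc, dirArc_one_add_sub_one hl.extent, List.flatMap_append,
      show i + 4 - 2 - e = i - 2 - e + 4 by grind]
    simp [SectionPaths.arc, add_assoc]
  rw [liftPaths_of_ne (sub_one_val_mod_two_ne.2 hi), sub_add_eq_add_sub, opposite,
    shiftPath_append, List.reverse_append, ← shiftPath_reverse (A := a _ ++ _), ← h.move,
    shiftPath_shiftPath, add_comm (sectionMove _ _ _), hl.vec_sub_one_add_sectionMove_source hi]

lemma liftPaths_append_add_one (h : IsSecondTour m n S r s a) (hl : IsLifting m n m' n' v t e)
    (hi : i.val % 2 = t) :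
    liftPaths v t e a i ++ liftPaths v t e a (i + 1) =
      shiftPath (v i) (a.arc (1 + e) (i + 1)) ++
        (shiftPath (v (i + 1)) (a.arc e (i + 4))).reverse := by
  rw [liftPaths_add_one h hl hi, liftPaths_of_eq hi, ← List.append_assoc, ← shiftPath_append]
  simp [SectionPaths.arc, dirArc_one_add_add_one hl.extent]

lemma liftPaths_sub_one_append (h : IsSecondTour m n S r s a) (hl : IsLifting m n m' n' v t e)
    (hi : i.val % 2 = t) :
    liftPaths v t e a (i - 1) ++ liftPaths v t e a i =
      (shiftPath (v (i - 1)) (a.arc e (i + 4))).reverse ++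
        shiftPath (v i) (a.arc (1 + e) (i - 1)) := by
  rw [liftPaths_sub_one h hl hi, liftPaths_of_eq hi, List.append_assoc, ← shiftPath_append]
  simp [SectionPaths.arc, dirArc_one_add_sub_one hl.extent]

lemma liftPaths_sub_one_append_add_one (h : IsSecondTour m n S r s a)
    (hl : IsLifting m n m' n' v t e) (hi : i.val % 2 = t) :
    liftPaths v t e a (i - 1) ++ liftPaths v t e a i ++ liftPaths v t e a (i + 1) =
      (shiftPath (v (i - 1)) (a.arc e (i + 4))).reverse ++ shiftPath (v i) (a.arc (2 + e) i) ++
        (shiftPath (v (i + 1)) (a.arc e (i + 4))).reverse := by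
  rw [liftPaths_sub_one h hl hi, liftPaths_add_one h hl hi, liftPaths_of_eq hi]
  simp [SectionPaths.arc, dirArc_two_add hl.extent, shiftPath_append]

lemma liftPaths_move (h : IsSecondTour m n S r s a) (hl : IsLifting m n m' n' v t e) (i : Fin 8) :
    shiftPath (sectionMove m' n' i) (liftPaths v t e a i ++ liftPaths v t e a (i + 1)) =
      (liftPaths v t e a (i + 4) ++ liftPaths v t e a (i + 5)).reverse := by
  by_cases hi : i.val % 2 = t
  · have hi4 : (i + 4).val % 2 = t := by rwa [add_four_val_mod_two]
    have hi5 : (i + 5).val % 2 ≠ t := by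
      rwa [show i + 5 = i + 4 + 1 by grind, add_one_val_mod_two_ne]
    rw [liftPaths_append_add_one h hl hi, liftPaths_of_eq hi4, liftPaths_of_ne hi5,
      show i + 5 + 4 = i + 1 by grind]
    simp only [shiftPath_append, List.reverse_append, List.reverse_reverse, ← shiftPath_reverse,
      shiftPath_shiftPath, hl.vec_add_sectionMove, hl.vec_add_one_add_sectionMove]
  · obtain ⟨j, rfl⟩ : ∃ j, i = j - 1 := ⟨i + 1, (add_sub_cancel_right i 1).symm⟩
    have hj : j.val % 2 = t := sub_one_val_mod_two_ne.1 hi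
    have hj3 : (j - 1 + 4).val % 2 ≠ t := by rwa [add_four_val_mod_two]
    have hj4 : (j - 1 + 5).val % 2 = t := by
      rwa [show j - 1 + 5 = j + 4 by grind, add_four_val_mod_two]
    have move_own : v j + sectionMove m' n' (j - 1) = v (j - 1 + 4) := by
      simpa using hl.vec_add_one_add_sectionMove (j - 1)
    rw [sub_add_cancel, liftPaths_sub_one_append h hl hj, liftPaths_of_ne hj3,
      liftPaths_of_eq hj4, show j - 1 + 5 = j + 4 by grind, show j - 1 + 4 + 4 = j - 1 by grind]
    simp only [shiftPath_append, List.reverse_append, List.reverse_reverse, ← shiftPath_reverse,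
      shiftPath_shiftPath, hl.vec_add_sectionMove, move_own]
    rw [show j - 1 + 5 = j + 4 by grind]

end LiftTours

section LiftTours

variable {m n m' n' : ℕ} {v : Fin 8 → Square} {t : Fin 2} {e i k : Fin 8} {S : Set Square}
  {r s : ℕ} {a : SectionPaths} {w x y : Square}

lemma liftPaths_nodup (h : IsSecondTour m n S r s a) (hl : IsLifting m n m' n' v t e) (i : Fin 8) :
    (liftPaths v t e a i).Nodup := by
  have nodup_arc (k) (hk : k ≤ 3) (i) : (a.arc k i).Nodup :=
    SectionPaths.nodup_arc h.nodup h.disjoint hk i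
  refine List.Nodup.map (add_left_injective _) ?_
  have he : e ≤ 3 ∧ 1 + e ≤ 3 := by rcases hl.extent with rfl | rfl <;> decide
  split_ifs
  · exact nodup_arc _ he.1 _
  · exact List.nodup_reverse.2 (nodup_arc _ he.2 _)

lemma liftPaths_isChain (h : IsSecondTour m n S r s a) (hl : IsLifting m n m' n' v t e)
    (i : Fin 8) : (liftPaths v t e a i ++ liftPaths v t e a (i + 1)).IsChain
      (leaperGraph r s).Adj := by
  have shift_arc (w k i) : (shiftPath w (a.arc k i)).IsChain (leaperGraph r s).Adj :=
    isChain_shiftPath (SectionPaths.isChain_arc h.ne_nil h.chain k i)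
  have isChain_of_ne {j : Fin 8} (hj : j.val % 2 ≠ t) :
      (liftPaths v t e a j).IsChain (leaperGraph r s).Adj := by
    rw [liftPaths_of_ne hj]
    exact isChain_reverse (shift_arc _ _ _)
  have shift_ne_nil (w i j) : shiftPath w (a i ++ a j) ≠ [] := by simp [shiftPath, h.ne_nil]
  by_cases hi : i.val % 2 = t
  · have right := isChain_of_ne (add_one_val_mod_two_ne.2 hi)
    rw [liftPaths_add_one h hl hi] at right ⊢
    rw [← List.append_assoc]
    refine List.IsChain.append_overlap ?_ right (shift_ne_nil _ _ _)
    have := shift_arc (v i) (1 + e) (i + 1)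
    rw [SectionPaths.arc, dirArc_one_add_add_one hl.extent] at this
    simpa [liftPaths_of_eq hi, SectionPaths.arc, shiftPath_append] using this
  · obtain ⟨j, rfl⟩ : ∃ j, i = j - 1 := ⟨i + 1, (add_sub_cancel_right i 1).symm⟩
    have hj : j.val % 2 = t := sub_one_val_mod_two_ne.1 hi
    have left := isChain_of_ne hi
    rw [sub_add_cancel]
    rw [liftPaths_sub_one h hl hj] at left ⊢
    refine List.IsChain.append_overlap left ?_ (shift_ne_nil _ _ _)
    have := shift_arc (v j) (1 + e) (j - 1)
    rw [SectionPaths.arc, dirArc_one_add_sub_one hl.extent] at this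
    simpa [liftPaths_of_eq hj, SectionPaths.arc, shiftPath_append] using this

lemma liftPaths_mem_section (h : IsSecondTour m n S r s a) (hl : IsLifting m n m' n' v t e)
    (i : Fin 8) (x : Square) (hx : x ∈ liftPaths v t e a i) : x ∈ frameSection m' n' i := by
  obtain ⟨k, hk, hx⟩ := mem_liftPaths.1 hx
  simpa using (hl.mem_frameSection_add_vec_iff (h.mem_section _ _ hx)).2 hk

lemma mem_liftSet_iff (h : IsSecondTour m n S r s a) (hl : IsLifting m n m' n' v t e) (x : Square) :
    x ∈ liftSet v m' n' S ↔ ∃ i, x ∈ liftPaths v t e a i := by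
  refine exists_congr fun i => ?_
  rw [mem_liftPaths, h.mem_iff]
  constructor
  · rintro ⟨hi, k, hk⟩
    exact ⟨k, (hl.mem_frameSection_add_vec_iff (h.mem_section _ _ hk)).1 (by simpa using hi), hk⟩
  · rintro ⟨k, hk, hx⟩
    exact ⟨by simpa using (hl.mem_frameSection_add_vec_iff (h.mem_section _ _ hx)).2 hk, k, hx⟩

lemma pair_infix_shiftPath_arc (h : IsSecondTour m n S r s a) (hk : k ≤ 3)
    (hx : x - w ∈ a.arc k i) (hy : y - w ∈ a.arc k i) (hxy : (leaperGraph r s).Adj x y) :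
    [x, y] <:+: shiftPath w (a.arc k i) ∨ [y, x] <:+: shiftPath w (a.arc k i) := by
  have mem_of_mem_arc {z} (hz : z ∈ a.arc k i) : z ∈ S :=
    (h.mem_iff z).2 ((SectionPaths.mem_arc.1 hz).imp fun _ => And.right)
  have shift {z z' : Square} (hz : [z - w, z' - w] <:+: a.arc k i) :
      [z, z'] <:+: shiftPath w (a.arc k i) := by
    simpa [shiftPath] using hz.map (· + w)
  have hxy' : (leaperGraph r s).Adj (x - w) (y - w) := by
    rwa [← leaperGraph_adj_add_right (z := w), sub_add_cancel, sub_add_cancel]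
  obtain ⟨j, hj⟩ := h.linked _ (mem_of_mem_arc hx) _ (mem_of_mem_arc hy) hxy'
  exact hj.imp (fun hj => shift (SectionPaths.pair_infix_arc h.disjoint hk hx hy hj))
    fun hj => shift (SectionPaths.pair_infix_arc h.disjoint hk hy hx hj)

lemma linked_of_mem_arc (h : IsSecondTour m n S r s a) (hl : IsLifting m n m' n' v t e)
    (hi : i.val % 2 = t) (hx : x - v i ∈ a.arc (2 + e) i) (hy : y - v i ∈ a.arc (2 + e) i)
    (hxy : (leaperGraph r s).Adj x y) : (liftPaths v t e a).Linked x y := by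
  have infix_append {x y} (hxy : [x, y] <:+: shiftPath (v i) (a.arc (2 + e) i)) :
      ∃ j, [x, y] <:+: liftPaths v t e a j ++ liftPaths v t e a (j + 1) := by
    have infix_three : [x, y] <:+: liftPaths v t e a (i - 1) ++ liftPaths v t e a i ++
        liftPaths v t e a (i + 1) := by
      rw [liftPaths_sub_one_append_add_one h hl hi]
      exact hxy.trans (List.infix_append _ _ _)
    rcases pair_infix_append_append (liftPaths_ne_nil h.ne_nil i) infix_three with hxy | hxy
    · exact ⟨i - 1, by rwa [sub_add_cancel]⟩
    · exact ⟨i, hxy⟩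
  have he : 2 + e ≤ 3 := by rcases hl.extent with rfl | rfl <;> decide
  rcases pair_infix_shiftPath_arc h he hx hy hxy with hxy | hxy
  · exact (infix_append hxy).imp fun _ => .inl
  · exact (infix_append hxy).imp fun _ => .inr

lemma sub_mem_arc_of_mem (hl : IsLifting m n m' n' v t e) (hi : i.val % 2 = t)
    (hx : x ∈ liftPaths v t e a i) : x - v i ∈ a.arc (2 + e) i := by
  rw [liftPaths_of_eq hi, mem_shiftPath] at hx
  rw [SectionPaths.arc, dirArc_two_add hl.extent, List.flatMap_append, List.flatMap_append]
  exact List.mem_append_left _ (List.mem_append_right _ hx)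

lemma sub_mem_centeredBoard_of_adj {k : ℤ} (hrs : r < s) (hk : 2 * s < k)
    (h : (leaperGraph r s).Adj x y) : x - y ∈ centeredBoard k := by
  have := h.2
  rw [mem_centeredBoard, Prod.fst_sub, Prod.snd_sub]
  omega

lemma sub_mem_arc_of_mem_add_one (h : IsSecondTour m n S r s a) (hl : IsLifting m n m' n' v t e)
    (hi : i.val % 2 = t) (hx : x ∈ liftPaths v t e a (i + 1)) (hxy : (leaperGraph r s).Adj x y)
    (hy : y ∈ frameSection m' n' i ∨ y ∈ frameSection m' n' (i - 1)) :
    x - v i ∈ a.arc (2 + e) i := by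
  rw [liftPaths_add_one h hl hi, List.mem_append, List.mem_reverse, mem_shiftPath,
    mem_shiftPath] at hx
  rcases hx with hx | hx
  · simp [SectionPaths.arc, dirArc_two_add hl.extent, List.mem_append.1 hx]
  · obtain ⟨k, hk, hx⟩ := SectionPaths.mem_arc.1 hx
    refine absurd ?_ (hl.add_vec_add_one_sub_notMem hi hk (h.mem_section _ _ hx) hy)
    rw [sub_add_cancel]
    exact sub_mem_centeredBoard_of_adj h.lt' (by have := h.le; omega) hxy

lemma sub_mem_arc_of_mem_sub_one (h : IsSecondTour m n S r s a) (hl : IsLifting m n m' n' v t e)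
    (hi : i.val % 2 = t) (hx : x ∈ liftPaths v t e a (i - 1)) (hxy : (leaperGraph r s).Adj x y)
    (hy : y ∈ frameSection m' n' i ∨ y ∈ frameSection m' n' (i + 1)) :
    x - v i ∈ a.arc (2 + e) i := by
  rw [liftPaths_sub_one h hl hi, List.mem_append, List.mem_reverse, mem_shiftPath,
    mem_shiftPath] at hx
  rcases hx with hx | hx
  · obtain ⟨k, hk, hx⟩ := SectionPaths.mem_arc.1 hx
    refine absurd ?_ (hl.add_vec_sub_one_sub_notMem hi hk (h.mem_section _ _ hx) hy)
    rw [sub_add_cancel]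
    exact sub_mem_centeredBoard_of_adj h.lt' (by have := h.le; omega) hxy
  · have := List.mem_append.1 hx
    simp only [SectionPaths.arc, dirArc_two_add hl.extent, List.flatMap_append, List.mem_append,
      List.flatMap_cons, List.flatMap_nil, List.append_nil]
    tauto

lemma linked_of_mem_of_mem (h : IsSecondTour m n S r s a) (hl : IsLifting m n m' n' v t e)
    (hx : x ∈ liftPaths v t e a i) (hy : y ∈ liftPaths v t e a i)
    (hxy : (leaperGraph r s).Adj x y) : (liftPaths v t e a).Linked x y := by
  by_cases hi : i.val % 2 = t
  · exact linked_of_mem_arc h hl hi (sub_mem_arc_of_mem hl hi hx) (sub_mem_arc_of_mem hl hi hy) hxy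
  · rw [liftPaths_of_ne hi, List.mem_reverse, mem_shiftPath] at hx hy
    have he : 1 + e ≤ 3 := by rcases hl.extent with rfl | rfl <;> decide
    refine ⟨i, (pair_infix_shiftPath_arc h he hx hy hxy).symm.imp ?_ ?_⟩ <;>
    · intro hxy
      refine List.IsInfix.trans ?_ (List.prefix_append _ _).isInfix
      rw [liftPaths_of_ne hi]
      exact pair_infix_reverse.2 hxy

lemma linked_of_mem_of_mem_add_one (h : IsSecondTour m n S r s a) (hl : IsLifting m n m' n' v t e)
    (hx : x ∈ liftPaths v t e a i) (hy : y ∈ liftPaths v t e a (i + 1))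
    (hxy : (leaperGraph r s).Adj x y) : (liftPaths v t e a).Linked x y := by
  have hx' := liftPaths_mem_section h hl _ x hx
  have hy' := liftPaths_mem_section h hl _ y hy
  by_cases hi : i.val % 2 = t
  · exact linked_of_mem_arc h hl hi (sub_mem_arc_of_mem hl hi hx)
      (sub_mem_arc_of_mem_add_one h hl hi hy hxy.symm (.inl hx')) hxy
  · obtain ⟨j, rfl⟩ : ∃ j, i = j - 1 := ⟨i + 1, (add_sub_cancel_right i 1).symm⟩
    have hj : j.val % 2 = t := sub_one_val_mod_two_ne.1 hi
    rw [sub_add_cancel] at hy hy'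
    exact linked_of_mem_arc h hl hj (sub_mem_arc_of_mem_sub_one h hl hj hx hxy (.inl hy'))
      (sub_mem_arc_of_mem hl hj hy) hxy

lemma linked_of_mem_of_mem_add_two (h : IsSecondTour m n S r s a) (hl : IsLifting m n m' n' v t e)
    (hs : s + m' ≤ n') (hx : x ∈ liftPaths v t e a i) (hy : y ∈ liftPaths v t e a (i + 2))
    (hxy : (leaperGraph r s).Adj x y) : (liftPaths v t e a).Linked x y := by
  have hx' := liftPaths_mem_section h hl _ x hx
  have hy' := liftPaths_mem_section h hl _ y hy
  by_cases hi : i.val % 2 = t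
  · rw [liftPaths_of_eq hi, mem_shiftPath] at hx
    obtain ⟨k, hk, hx⟩ := SectionPaths.mem_arc.1 hx
    refine absurd ?_ (hl.add_vec_sub_notMem hi hk (h.mem_section _ _ hx) hy')
    rw [sub_add_cancel]
    exact sub_mem_centeredBoard_of_adj h.lt' (by omega) hxy
  · obtain ⟨j, rfl⟩ : ∃ j, i = j - 1 := ⟨i + 1, (add_sub_cancel_right i 1).symm⟩
    have hj : j.val % 2 = t := sub_one_val_mod_two_ne.1 hi
    rw [show j - 1 + 2 = j + 1 by grind] at hy hy'
    exact linked_of_mem_arc h hl hj (sub_mem_arc_of_mem_sub_one h hl hj hx hxy (.inr hy'))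
      (sub_mem_arc_of_mem_add_one h hl hj hy hxy.symm (.inr hx')) hxy

end LiftTours

section Spread

variable {p q r s : ℕ} {i j : Fin 8} {u x y : Square}

/-- The inner squares of a radial tour, on the ray or in the quadrant of direction `i` from `u`. -/
def IsInner (q s : ℕ) (u : Square) (i : Fin 8) (x : Square) : Prop :=
  ((x.1 - u.1).sign = (dirVec i).1 ∧ (x.2 - u.2).sign = (dirVec i).2) ∧
    (|x.1 - u.1| ≤ q - s ∧ |x.2 - u.2| ≤ q - s) ∧ x.1 - u.1 + (x.2 - u.2) ≡ q - s [ZMOD 2]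

/-- The outer squares of a radial tour, in the quadrant of direction `i` from `u` and at distance
at least `s` from its sides. -/
def IsOuter (p s : ℕ) (u : Square) (i : Fin 8) (x : Square) : Prop :=
  (s ≤ (dirVec i).1 * (x.1 - u.1) ∧ (dirVec i).1 * (x.1 - u.1) ≤ p) ∧
    (s ≤ (dirVec i).2 * (x.2 - u.2) ∧ (dirVec i).2 * (x.2 - u.2) ≤ p) ∧
      x.1 - u.1 + (x.2 - u.2) ≡ p - s [ZMOD 2]

/-- A shape of second tours that is preserved by the lifting `g`: every square is inner or outer
with respect to `u`. -/
def IsRadial (p q s : ℕ) (u : Square) (a : SectionPaths) : Prop :=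
  ∀ i, ∀ x ∈ a i, IsInner q s u i x ∨ IsOuter p s u i x

lemma near_of_isOuter_of_isInner (hrs : r < s) (hx : IsOuter p s u i x) (hy : IsInner q s u j y)
    (hxy : (leaperGraph r s).Adj x y) : j = i ∨ j = i + 1 ∨ i = j + 1 := by
  have near_of_ne_neg : ∀ i j : Fin 8, (dirVec i).1 ≠ 0 → (dirVec i).2 ≠ 0 →
      (dirVec j).1 ≠ -(dirVec i).1 → (dirVec j).2 ≠ -(dirVec i).2 →
      j = i ∨ j = i + 1 ∨ i = j + 1 := by
    decide
  have ne_neg {c z z' : ℤ} (hc : c = 0 ∨ c = 1 ∨ c = -1) (hz : s ≤ c * z)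
      (hzz' : -s ≤ z - z' ∧ z - z' ≤ s) : c ≠ 0 ∧ z'.sign ≠ -c := by
    rcases hc with rfl | rfl | rfl
    · omega
    · exact ⟨by decide, mt Int.sign_eq_neg_one_iff_neg.1 (by omega)⟩
    · exact ⟨by decide, mt Int.sign_eq_one_iff_pos.1 (by omega)⟩
  have hadj := hxy.2
  obtain ⟨h₁, h₁'⟩ := ne_neg (dirVec_fst_eq i) hx.1.1 (z' := y.1 - u.1) (by omega)
  obtain ⟨h₂, h₂'⟩ := ne_neg (dirVec_snd_eq i) hx.2.1.1 (z' := y.2 - u.2) (by omega)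
  rw [hy.1.1] at h₁'
  rw [hy.1.2] at h₂'
  exact near_of_ne_neg i j h₁ h₂ h₁' h₂'

lemma IsRadial.near {a : SectionPaths} (h : IsRadial p q s u a) (hpq : Odd (p + q)) (hrs : r < s)
    (hodd : Odd (r + s)) (hx : x ∈ a i) (hy : y ∈ a j) (hxy : (leaperGraph r s).Adj x y) :
    j = i ∨ j = i + 1 ∨ i = j + 1 := by
  obtain ⟨c, hc⟩ := hpq
  obtain ⟨c', hc'⟩ := hodd
  have hadj := hxy.2
  rcases h i x hx with hx | hx <;> rcases h j y hy with hy | hy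
  · have hxs := hx.2.2
    have hys := hy.2.2
    simp only [Int.ModEq] at hxs hys
    omega
  · have := near_of_isOuter_of_isInner hrs hy hx hxy.symm
    tauto
  · exact near_of_isOuter_of_isInner hrs hx hy hxy
  · have hxs := hx.2.2
    have hys := hy.2.2
    simp only [Int.ModEq] at hxs hys
    omega

lemma InStrip.lt_sub_or_lt_sub {e e' x y : ℤ} (hx : InStrip p q e x) (hy : InStrip p q e' y)
    (he : e * e' = -1) : (q : ℤ) - p < x - y ∨ (q : ℤ) - p < y - x := by
  rcases Int.mul_eq_neg_one_iff_eq_one_or_neg_one.1 he with ⟨rfl, rfl⟩ | ⟨rfl, rfl⟩ <;>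
    simp only [inStrip_one, inStrip_neg_one] at hx hy <;> omega

lemma near_of_add_le (hs : s + p ≤ q) (hrs : r < s) (hx : x ∈ frameSection p q i)
    (hy : y ∈ frameSection p q j) (hxy : (leaperGraph r s).Adj x y) :
    j = i ∨ j = i + 1 ∨ i = j + 1 ∨ j = i + 2 ∨ i = j + 2 := by
  have opposite_or_near : ∀ i j : Fin 8,
      ((dirVec i).1 * (dirVec j).1 = -1 ∨ (dirVec i).2 * (dirVec j).2 = -1) ∨
        (j = i ∨ j = i + 1 ∨ i = j + 1 ∨ j = i + 2 ∨ i = j + 2) := by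
    decide
  refine (opposite_or_near i j).resolve_left ?_
  have hadj := hxy.2
  rw [mem_frameSection] at hx hy
  rintro (h | h)
  · have := hx.1.lt_sub_or_lt_sub hy.1 h
    omega
  · have := hx.2.lt_sub_or_lt_sub hy.2 h
    omega

/-- A sufficient condition for the squares of distant sections not to be joined by a move. -/
def IsSpread (p q s : ℕ) (a : SectionPaths) : Prop := s + p ≤ q ∨ ∃ u, IsRadial p q s u a

variable {m n m' n' : ℕ} {v : Fin 8 → Square} {t : Fin 2} {e : Fin 8} {S : Set Square}
  {a : SectionPaths}

lemma IsRadial.gLift (h : IsRadial m n s u a) (hmn : m < n) (hs : s ≤ m) (hs0 : 0 < s) :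
    IsRadial n (2 * n - m) s u (liftPaths (gVec m n) 0 0 a) := by
  intro i x hx
  obtain ⟨k, hk, hx⟩ := mem_liftPaths.1 hx
  have hxk := h k _ hx
  have hcast : ((2 * n - m : ℕ) : ℤ) = 2 * n - m := by omega
  simp only [IsInner, IsOuter, abs_le, hcast, gVec, liftVec, Int.ModEq, Prod.fst_sub,
    Prod.snd_sub] at hxk ⊢
  clear h hx hcast
  fin_cases i <;> fin_cases k <;> first
    | exact absurd hk (by decide)
    | simp [dirVec, IsSide, Int.sign_eq_one_iff_pos, Int.sign_eq_neg_one_iff_neg] at hxk ⊢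
      omega

lemma IsSecondTour.lift (h : IsSecondTour m n S r s a) (hl : IsLifting m n m' n' v t e)
    (hspread : IsSpread m' n' s (liftPaths v t e a)) :
    IsSecondTour m' n' (liftSet v m' n' S) r s (liftPaths v t e a) where
  lt := hl.lt'
  odd := hl.odd'
  odd' := h.odd'
  lt' := h.lt'
  le := h.le.trans hl.le'
  mem_section := liftPaths_mem_section h hl
  mem_iff := mem_liftSet_iff h hl
  ne_nil := liftPaths_ne_nil h.ne_nil
  nodup := liftPaths_nodup h hl
  move := liftPaths_move h hl
  chain := liftPaths_isChain h hl
  linked x hx y hy hxy := by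
    obtain ⟨i, hi⟩ := (mem_liftSet_iff h hl x).1 hx
    obtain ⟨j, hj⟩ := (mem_liftSet_iff h hl y).1 hy
    have hnear : j = i ∨ j = i + 1 ∨ i = j + 1 ∨ ((j = i + 2 ∨ i = j + 2) ∧ s + m' ≤ n') := by
      rcases hspread with hs | ⟨u, hu⟩
      · have := near_of_add_le hs h.lt' (liftPaths_mem_section h hl _ x hi)
          (liftPaths_mem_section h hl _ y hj) hxy
        tauto
      · have := hu.near hl.odd' h.lt' h.odd' hi hj hxy
        tauto
    rcases hnear with rfl | rfl | rfl | ⟨rfl | rfl, hs⟩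
    · exact linked_of_mem_of_mem h hl hi hj hxy
    · exact linked_of_mem_of_mem_add_one h hl hi hj hxy
    · exact (linked_of_mem_of_mem_add_one h hl hj hi hxy.symm).symm
    · exact linked_of_mem_of_mem_add_two h hl hs hi hj hxy
    · exact (linked_of_mem_of_mem_add_two h hl hs hj hi hxy.symm).symm

end Spread

section Components

variable {m n : ℕ} {x y : Square}

lemma encard_neighborSet_inter_centeredBoard_le_two (hmn : m < n) (hodd : Odd (m + n))
    (hx : x ∈ centeredBoard (m + n)) :
    ((leaperGraph m n).neighborSet x ∩ centeredBoard (m + n)).encard ≤ 2 := by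
  obtain h | ⟨y, hxy, hy⟩ :=
    Set.eq_empty_or_nonempty ((leaperGraph m n).neighborSet x ∩ centeredBoard (m + n))
  · simp [h]
  · obtain ⟨k, hk⟩ := exists_mem_frameSection hodd (mem_frame_of_adj hx hy hxy)
    have hsub : (leaperGraph m n).neighborSet x ∩ centeredBoard (m + n) ⊆
        {x + sectionMove m n k, x + sectionMove m n (k + 7)} :=
      fun z hz => eq_add_sectionMove hmn hk hz.2 hz.1
    refine (Set.encard_le_encard hsub).trans ((Set.encard_insert_le _ _).trans_eq ?_)
    rw [Set.encard_singleton, one_add_one_eq_two]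

lemma isComponentOf_squares (hmn : m < n) (hodd : Odd (m + n)) {u : Square}
    {C : (leaperGraph m n).Walk u u} (hC : C.IsCycle) (hsub : squares C ⊆ frame m n) :
    IsComponentOf (leaperGraph m n) (frame m n) (squares C) :=
  (isComponentOf_of_encard_neighborSet_le_two hC (hsub.trans fun _ hx => hx.1)
    fun _ hx => encard_neighborSet_inter_centeredBoard_le_two hmn hodd hx).mono hsub
      fun _ hx => hx.1

lemma exists_eq_add_sectionMove (hmn : m < n) (hodd : Odd (m + n))
    (hx : x ∈ frame m n) (hy : y ∈ frame m n) (hxy : (leaperGraph m n).Adj x y) :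
    ∃ k, y = x + sectionMove m n k ∧ (x ∈ frameSection m n k ∨ x ∈ frameSection m n (k + 1)) ∧
      (y ∈ frameSection m n (k + 4) ∨ y ∈ frameSection m n (k + 5)) := by
  obtain ⟨k, hk⟩ := exists_mem_frameSection hodd hx
  have hk' : x ∈ frameSection m n (k + 7 + 1) := by rwa [show k + 7 + 1 = k by grind]
  rcases eq_add_sectionMove hmn hk hy.1 hxy with rfl | rfl
  · exact ⟨k, rfl, Or.inl hk, add_sectionMove_mem hmn hodd (Or.inl hk)⟩
  · exact ⟨k + 7, rfl, Or.inr hk', add_sectionMove_mem hmn hodd (Or.inr hk')⟩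

end Components

section Copies

variable {m n m' n' : ℕ} {v : Fin 8 → Square} {t : Fin 2} {e : Fin 8} {i j k : Fin 8}
  {S T : Set Square} {x y z : Square}

lemma exists_eq_add_mul_of_mem_sources (he : e = 0 ∨ e = 1) (hi : k ∈ sources t e i)
    (hj : k ∈ sources t e j) :
    ∃ d : Fin 8, (d = 3 ∨ d = 5) ∧ ∃ l < 5, j = i + Fin.ofNat 8 l * d ∧
      ∀ l' < l, k ∈ sources t e (i + Fin.ofNat 8 l' * d) := by
  rcases he with rfl | rfl <;> decide +revert

lemma of_mem_sources {P : Fin 8 → Prop} (he : e = 0 ∨ e = 1) (hi : k ∈ sources t e i)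
    (hj : k ∈ sources t e j) (hPi : P i)
    (hP : ∀ i, k ∈ sources t e i → P i → P (i + 3) ∧ P (i + 5)) : P j := by
  obtain ⟨d, hd, l, -, rfl, hl⟩ := exists_eq_add_mul_of_mem_sources he hi hj
  clear hj
  induction l with
  | zero => simpa using hPi
  | succ l ih =>
    have hsucc : i + Fin.ofNat 8 (l + 1) * d = i + Fin.ofNat 8 l * d + d := by
      have : Fin.ofNat 8 (l + 1) = Fin.ofNat 8 l + 1 := by simp [Fin.ext_iff, Fin.val_add]
      rw [this, add_one_mul, add_assoc]
    have hPl := hP _ (hl l l.lt_succ_self) (ih fun l' hl' => hl l' (hl'.trans l.lt_succ_self))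
    rw [hsucc]
    rcases hd with rfl | rfl
    exacts [hPl.1, hPl.2]

lemma exists_edge_sources (he : e = 0 ∨ e = 1) (k : Fin 8) : ∃ i : Fin 8, i.val % 2 = t ∧
    ((k = i + 1 + e ∧ k ∈ sources t e (i + 5) ∧ k + 1 ∈ sources t e (i + 5) ∧
        k + 4 ∈ sources t e (i + 1) ∧ k + 4 + 1 ∈ sources t e (i + 1)) ∨
      (k = i - 2 - e ∧ k ∈ sources t e (i + 3) ∧ k + 1 ∈ sources t e (i + 3) ∧
        k + 4 ∈ sources t e (i - 1) ∧ k + 4 + 1 ∈ sources t e (i - 1))) := by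
  rcases he with rfl | rfl <;> decide +revert

namespace IsLifting

lemma adj_add_vec_add_five (hl : IsLifting m n m' n' v t e) (x : Square) (i : Fin 8) :
    (leaperGraph m' n').Adj (x + v i) (x + v (i + 5)) := by
  rw [← hl.vec_add_sectionMove, ← add_assoc]
  exact leaperGraph_adj_sectionMove (Nat.zero_lt_of_lt hl.lt') _ _

lemma adj_add_vec_add_three (hl : IsLifting m n m' n' v t e) (x : Square) (i : Fin 8) :
    (leaperGraph m' n').Adj (x + v i) (x + v (i + 3)) := by
  have := hl.adj_add_vec_add_five x (i + 3)
  rw [show i + 3 + 5 = i by grind] at this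
  exact this.symm

lemma vec_add_sectionMove_add_seven (hl : IsLifting m n m' n' v t e) (i : Fin 8) :
    v i + sectionMove m' n' (i + 7) = v (i + 3) := by
  have := hl.vec_add_one_add_sectionMove (i + 7)
  rwa [show i + 7 + 1 = i by grind, show i + 7 + 4 = i + 3 by grind] at this

lemma add_vec_add_five_mem (hl : IsLifting m n m' n' v t e)
    (hx : x + v i ∈ frameSection m' n' i) :
    x + v (i + 5) ∈ frameSection m' n' (i + 4) ∨ x + v (i + 5) ∈ frameSection m' n' (i + 5) := by
  rw [← hl.vec_add_sectionMove, ← add_assoc]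
  exact add_sectionMove_mem hl.lt' hl.odd' (Or.inl hx)

lemma add_vec_add_three_mem (hl : IsLifting m n m' n' v t e)
    (hx : x + v i ∈ frameSection m' n' i) :
    x + v (i + 3) ∈ frameSection m' n' (i + 4) ∨ x + v (i + 3) ∈ frameSection m' n' (i + 3) := by
  have hx' : x + v i ∈ frameSection m' n' (i + 7 + 1) := by rwa [show i + 7 + 1 = i by grind]
  have := add_sectionMove_mem hl.lt' hl.odd' (Or.inr hx')
  rwa [show i + 7 + 4 = i + 3 by grind, show i + 7 + 5 = i + 4 by grind, add_assoc,
    hl.vec_add_sectionMove_add_seven, or_comm] at this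

lemma eq_add_vec_of_adj (hl : IsLifting m n m' n' v t e) (hx : x + v i ∈ frameSection m' n' i)
    (hy : y ∈ frame m' n') (hxy : (leaperGraph m' n').Adj (x + v i) y) :
    y = x + v (i + 3) ∨ y = x + v (i + 5) := by
  have := eq_add_sectionMove hl.lt' hx hy.1 hxy
  rwa [add_assoc, add_assoc, hl.vec_add_sectionMove, hl.vec_add_sectionMove_add_seven,
    or_comm] at this

lemma adj_vec_add_one (hl : IsLifting m n m' n' v t e) (i : Fin 8) :
    (leaperGraph m n).Adj (v i) (v (i + 1)) := by
  have hn : 0 < n := by have := hl.lt; omega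
  by_cases hi : i.val % 2 = t
  · rw [← hl.vec_add_one_add_sectionMove_source hi]
    exact (leaperGraph_adj_sectionMove hn _ _).symm
  · have hi' : (i + 1).val % 2 = t := not_not.1 (mt add_one_val_mod_two_ne.1 hi)
    rw [← hl.vec_sub_one_add_sectionMove_source hi', add_sub_cancel_right]
    exact leaperGraph_adj_sectionMove hn _ _

lemma exists_sub_vec_eq_or_adj (hl : IsLifting m n m' n' v t e) (hx : x ∈ frame m n)
    (hxi : x + v i ∈ frameSection m' n' i) (hy : y ∈ frame m' n')
    (hxy : (leaperGraph m' n').Adj (x + v i) y) :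
    ∃ z, (z = x ∨ z ∈ frame m n ∧ (leaperGraph m n).Adj x z) ∧
      ∃ j, z + v j = y ∧ y ∈ frameSection m' n' j := by
  have hstep {j k} (hjk : (leaperGraph m n).Adj (v k) (v j))
      (hk : x + v j ∈ frameSection m' n' k) :
      x + v j - v k ∈ frame m n ∧ (leaperGraph m n).Adj x (x + v j - v k) := by
    have hadj : (leaperGraph m n).Adj x (x + v j - v k) := by
      rw [← leaperGraph_adj_add_right (z := v k), sub_add_cancel]
      rwa [add_comm x, add_comm x, leaperGraph_adj_add_right]
    exact ⟨mem_frame_of_adj (hl.sub_vec_mem_centeredBoard hk) hx.1 hadj.symm, hadj⟩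
  rcases hl.eq_add_vec_of_adj hxi hy hxy with rfl | rfl
  · rcases hl.add_vec_add_three_mem hxi with h | h
    · have := hl.adj_vec_add_one (i + 3)
      rw [show i + 3 + 1 = i + 4 by grind] at this
      exact ⟨_, Or.inr (hstep this.symm h), i + 4, sub_add_cancel _ _, h⟩
    · exact ⟨x, Or.inl rfl, i + 3, rfl, h⟩
  · rcases hl.add_vec_add_five_mem hxi with h | h
    · have := hl.adj_vec_add_one (i + 4)
      rw [show i + 4 + 1 = i + 5 by grind] at this
      exact ⟨_, Or.inr (hstep this h), i + 4, sub_add_cancel _ _, h⟩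
    · exact ⟨x, Or.inl rfl, i + 5, rfl, h⟩

lemma exists_adj_add_vec (hl : IsLifting m n m' n' v t e) (hx : x ∈ frame m n)
    (hy : y ∈ frame m n) (hxy : (leaperGraph m n).Adj x y) :
    ∃ i j, x + v i ∈ frameSection m' n' i ∧ y + v j ∈ frameSection m' n' j ∧
      (leaperGraph m' n').Adj (x + v i) (y + v j) := by
  obtain ⟨k, rfl, hxk, hyk⟩ := exists_eq_add_sectionMove hl.lt hl.odd hx hy hxy
  have hmem {z : Square} {j l : Fin 8} (hj : j ∈ sources t e l) (hj' : j + 1 ∈ sources t e l)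
      (hz : z ∈ frameSection m n j ∨ z ∈ frameSection m n (j + 1)) :
      z + v l ∈ frameSection m' n' l :=
    hz.elim (fun h => (hl.mem_frameSection_add_vec_iff h).2 hj)
      fun h => (hl.mem_frameSection_add_vec_iff h).2 hj'
  rw [show k + 5 = k + 4 + 1 by grind] at hyk
  obtain ⟨i, hi, ⟨rfl, h₁, h₂, h₃, h₄⟩ | ⟨rfl, h₁, h₂, h₃, h₄⟩⟩ :=
    exists_edge_sources (t := t) hl.extent k
  · refine ⟨i + 5, i + 1, hmem h₁ h₂ hxk, hmem h₃ h₄ hyk, ?_⟩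
    rw [add_assoc, add_comm (sectionMove _ _ _), hl.vec_add_one_add_sectionMove_source hi]
    exact (hl.adj_add_vec_add_five x i).symm
  · refine ⟨i + 3, i - 1, hmem h₁ h₂ hxk, hmem h₃ h₄ hyk, ?_⟩
    rw [add_assoc, add_comm (sectionMove _ _ _), hl.vec_sub_one_add_sectionMove_source hi]
    exact (hl.adj_add_vec_add_three x i).symm

end IsLifting

lemma isClosedIn_liftSet (hl : IsLifting m n m' n' v t e)
    (hT : IsClosedIn (leaperGraph m n) (frame m n) T) :
    IsClosedIn (leaperGraph m' n') (frame m' n') (liftSet v m' n' (T ∩ frame m n)) := by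
  rintro x ⟨i, hxi, hxT, hxF⟩ - y hy hxy
  rw [← sub_add_cancel x (v i)] at hxi hxy
  obtain ⟨z, hz, j, rfl, hyj⟩ := hl.exists_sub_vec_eq_or_adj hxF hxi hy hxy
  refine ⟨j, hyj, ?_⟩
  rw [add_sub_cancel_right]
  rcases hz with rfl | ⟨hzF, hadj⟩
  exacts [⟨hxT, hxF⟩, ⟨hT _ hxT hxF z hzF hadj, hzF⟩]

lemma IsClosedIn.add_vec_add_three_and_five_mem (hl : IsLifting m n m' n' v t e)
    (hS : IsClosedIn (leaperGraph m' n') (frame m' n') S)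
    (hi : x + v i ∈ frameSection m' n' i) (hiS : x + v i ∈ S) :
    x + v (i + 3) ∈ S ∧ x + v (i + 5) ∈ S := by
  have hsub {y : Square} {j k : Fin 8}
      (hy : y ∈ frameSection m' n' j ∨ y ∈ frameSection m' n' k) : y ∈ frame m' n' :=
    hy.elim (fun h => frameSection_subset hl.lt' _ h) fun h => frameSection_subset hl.lt' _ h
  have hmem := frameSection_subset hl.lt' _ hi
  exact ⟨hS _ hiS hmem _ (hsub (hl.add_vec_add_three_mem hi)) (hl.adj_add_vec_add_three x i),
    hS _ hiS hmem _ (hsub (hl.add_vec_add_five_mem hi)) (hl.adj_add_vec_add_five x i)⟩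

lemma IsClosedIn.add_vec_mem (hl : IsLifting m n m' n' v t e)
    (hS : IsClosedIn (leaperGraph m' n') (frame m' n') S) (hx : x ∈ frame m n)
    (hi : x + v i ∈ frameSection m' n' i) (hiS : x + v i ∈ S)
    (hj : x + v j ∈ frameSection m' n' j) : x + v j ∈ S := by
  obtain ⟨k, hk⟩ := exists_mem_frameSection hl.odd hx
  refine of_mem_sources (P := fun l => x + v l ∈ S) hl.extent
    ((hl.mem_frameSection_add_vec_iff hk).1 hi)
    ((hl.mem_frameSection_add_vec_iff hk).1 hj) hiS fun l hkl hlS => ?_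
  exact hS.add_vec_add_three_and_five_mem hl ((hl.mem_frameSection_add_vec_iff hk).2 hkl) hlS

/-- The squares of the `(m, n)`-frame with a copy, under the translations `v` of a lifting, in the
set `S` of squares of the `(m', n')`-frame. -/
def copySet (v : Fin 8 → Square) (m n m' n' : ℕ) (S : Set Square) : Set Square :=
  {x ∈ frame m n | ∃ i, x + v i ∈ frameSection m' n' i ∧ x + v i ∈ S}

lemma isClosedIn_copySet (hl : IsLifting m n m' n' v t e)
    (hS : IsClosedIn (leaperGraph m' n') (frame m' n') S) :
    IsClosedIn (leaperGraph m n) (frame m n) (copySet v m n m' n' S) := by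
  rintro x ⟨hx, l, hl', hlS⟩ - y hy hxy
  obtain ⟨i, j, hi, hj, hadj⟩ := hl.exists_adj_add_vec hx hy hxy
  exact ⟨hy, j, hj, hS _ (hS.add_vec_mem hl hx hl' hlS hi) (frameSection_subset hl.lt' _ hi) _
    (frameSection_subset hl.lt' _ hj) hadj⟩

lemma sub_mem_copySet (hx : x ∈ S) (hi : x ∈ frameSection m' n' i)
    (hF : x - v i ∈ frame m n) : x - v i ∈ copySet v m n m' n' S :=
  ⟨hF, i, by rwa [sub_add_cancel], by rwa [sub_add_cancel]⟩

lemma IsComponentOf.subset_liftSet (hl : IsLifting m n m' n' v t e)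
    (hS : IsComponentOf (leaperGraph m' n') (frame m' n') S)
    (hT : IsClosedIn (leaperGraph m n) (frame m n) T)
    (hST : (copySet v m n m' n' S ∩ T).Nonempty) :
    S ⊆ liftSet v m' n' (T ∩ frame m n) := by
  obtain ⟨x, ⟨hx, i, hi, hiS⟩, hxT⟩ := hST
  refine hS.subset_of_isClosedIn _ (isClosedIn_liftSet hl hT) ⟨_, hiS, i, hi, ?_⟩
  rw [add_sub_cancel_right]
  exact ⟨hxT, hx⟩

lemma isComponentOf_copySet (hl : IsLifting m n m' n' v t e)
    (hS : IsComponentOf (leaperGraph m' n') (frame m' n') S)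
    (hne : (copySet v m n m' n' S).Nonempty) :
    IsComponentOf (leaperGraph m n) (frame m n) (copySet v m n m' n' S) where
  nonempty := hne
  subset _ hx := hx.1
  isClosedIn := isClosedIn_copySet hl hS.isClosedIn
  subset_of_isClosedIn T hT hST := by
    rintro x ⟨-, i, hi, hiS⟩
    obtain ⟨j, hj, hxT, -⟩ := hS.subset_liftSet hl hT hST hiS
    rw [frameSection_disjoint hl.lt' hj hi, add_sub_cancel_right] at hxT
    exact hxT

lemma IsComponentOf.eq_liftSet_copySet (hl : IsLifting m n m' n' v t e)
    (hS : IsComponentOf (leaperGraph m' n') (frame m' n') S)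
    (hne : (copySet v m n m' n' S).Nonempty) :
    S = liftSet v m' n' (copySet v m n m' n' S) := by
  refine Set.Subset.antisymm ?_ ?_
  · have hsub := hS.subset_liftSet hl (isClosedIn_copySet hl hS.isClosedIn)
      (by rwa [Set.inter_self])
    exact hsub.trans fun x ⟨i, hi, hx⟩ => ⟨i, hi, hx.1⟩
  · rintro x ⟨i, hi, hx, j, hj, hjS⟩
    have := hS.isClosedIn.add_vec_mem hl hx hj hjS (by rwa [sub_add_cancel])
    rwa [sub_add_cancel] at this

end Copies

section Holes

variable {m n m' n' : ℕ} {v : Fin 8 → Square} {t : Fin 2} {e : Fin 8} {i l : Fin 8}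
  {S : Set Square} {u : Square}

lemma forall_of_add_three {P : Fin 8 → Prop} (hi : P i) (hP : ∀ k, P k → P (k + 3)) : ∀ j, P j := by
  have hiter (k : ℕ) : P (i + k • (3 : Fin 8)) := by
    induction k with
    | zero => rwa [zero_smul, add_zero]
    | succ k ih => rw [succ_nsmul, ← add_assoc]; exact hP _ ih
  intro j
  have hj : ∀ i j : Fin 8, j = i + (3 * (j - i)).val • (3 : Fin 8) := by decide
  rw [hj i j]
  exact hiter _

lemma IsComponentOf.eq_range (hl : IsLifting m n m' n' v t e)
    (hS : IsComponentOf (leaperGraph m' n') (frame m' n') S)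
    (hu : ∀ i, u + v i ∈ frameSection m' n' i) (h : u + v l ∈ S) :
    S = Set.range fun i => u + v i := by
  refine Set.Subset.antisymm (hS.subset_of_isClosedIn _ ?_ ⟨_, h, l, rfl⟩) ?_
  · rintro _ ⟨i, rfl⟩ - y hy hxy
    rcases hl.eq_add_vec_of_adj (hu i) hy hxy with rfl | rfl
    exacts [⟨i + 3, rfl⟩, ⟨i + 5, rfl⟩]
  · rintro _ ⟨i, rfl⟩
    exact forall_of_add_three (P := fun i => u + v i ∈ S) h
      (fun i hi => (hS.isClosedIn.add_vec_add_three_and_five_mem hl (hu i) hi).1) i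

lemma IsLifting.exists_isCycle (hl : IsLifting m n m' n' v t e)
    (hu : ∀ i, u + v i ∈ frameSection m' n' i) :
    ∃ C : (leaperGraph m' n').Walk (u + v 0) (u + v 0), C.IsCycle ∧
      squares C = Set.range fun i => u + v i := by
  have hinj : Function.Injective fun i => u + v i := fun i j (hij : u + v i = u + v j) =>
    frameSection_disjoint hl.lt' (hij ▸ hu i) (hu j)
  have hnd : (([0, 3, 6, 1, 4, 7, 2, 5] : List (Fin 8)).map fun i => u + v i).Nodup :=
    List.Nodup.map hinj (by decide)
  have hadj := hl.adj_add_vec_add_three u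
  obtain ⟨C, hC, hsupp⟩ := exists_isCycle_of_isChain (G := leaperGraph m' n') hnd (by simp) <| by
    simp only [List.map_cons, List.map_nil, List.cons_append, List.nil_append,
      List.isChain_cons_cons, List.isChain_singleton, and_true]
    exact ⟨hadj 0, hadj 3, hadj 6, hadj 1, hadj 4, hadj 7, hadj 2, hadj 5⟩
  refine ⟨C, hC, Set.Subset.antisymm (fun x hx => ?_) ?_⟩
  · simp only [squares, hsupp, Set.mem_ofPred_eq] at hx
    grind
  · rintro _ ⟨i, rfl⟩
    fin_cases i <;> simp [squares, hsupp]

end Holes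

section Shells

variable {m n n' : ℕ} {v : Fin 8 → Square} {t : Fin 2} {e : Fin 8} {i j : Fin 8}
  {u x : Square}

namespace IsLifting

lemma add_vec_mem_of_mem_hole (hl : IsLifting m n n n' v t e)
    (hu : u ∈ centeredBoard (n - m)) (i : Fin 8) : u + v i ∈ frameSection n n' i := by
  have := hl.lt
  have := hl.type
  induction i using direction_induction generalizing u with
  | add_two i ih =>
    obtain ⟨u, rfl⟩ := quarterTurn.surjective u
    rw [quarterTurn_mem_centeredBoard] at hu
    rw [hl.vec_add_two, ← map_add, quarterTurn_mem_frameSection]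
    exact ih hu
  | _ =>
    simp only [mem_frameSection, dirVec, Matrix.cons_val, inStrip_zero, inStrip_one, hl.vec_zero,
      hl.vec_one, Prod.fst_add, Prod.snd_add]
    rw [mem_centeredBoard] at hu
    omega

lemma near_of_adj_vec (hl : IsLifting m n n n' v t e)
    (hij : (leaperGraph m n).Adj (v i) (v j)) : j = i + 1 ∨ i = j + 1 := by
  have := hl.lt
  have := hl.type
  induction i using direction_induction generalizing j with
  | add_two i ih =>
    obtain ⟨j, rfl⟩ := (Equiv.addRight (2 : Fin 8)).surjective j
    rw [Equiv.coe_addRight, hl.vec_add_two, hl.vec_add_two, leaperGraph_adj_quarterTurn] at hij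
    rw [Equiv.coe_addRight, add_right_comm i, add_right_comm j, add_left_inj, add_left_inj]
    exact ih hij
  | _ =>
    have hij' := hij.2
    fin_cases j <;> first
      | decide
      | simp +decide only [hl.vec_eq, liftVec, dirVec, Fin.reduceFinMk, Matrix.cons_val,
          reduceIte, Prod.smul_mk, smul_eq_mul] at hij'
        omega

lemma isSecondTour_range (hl : IsLifting m n n n' v t e)
    (hu : ∀ i, u + v i ∈ frameSection n n' i) :
    IsSecondTour n n' (Set.range fun i => u + v i) m n fun i => [u + v i] where
  lt := hl.lt'
  odd := hl.odd'
  odd' := hl.odd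
  lt' := hl.lt
  le := le_rfl
  mem_section i x hx := by
    rw [List.mem_singleton] at hx
    exact hx ▸ hu i
  mem_iff x := by simp only [Set.mem_range, List.mem_singleton, eq_comm]
  ne_nil i := List.cons_ne_nil _ _
  nodup i := List.nodup_singleton _
  move i := by
    simp only [shiftPath, List.singleton_append, List.map_cons, List.map_nil, List.reverse_cons,
      List.reverse_nil, List.nil_append, add_assoc, hl.vec_add_sectionMove,
      hl.vec_add_one_add_sectionMove]
  chain i := by
    rw [List.singleton_append, List.isChain_pair, add_comm u, add_comm u, leaperGraph_adj_add_right]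
    exact hl.adj_vec_add_one i
  linked := by
    rintro _ ⟨i, rfl⟩ _ ⟨j, rfl⟩ (hij : (leaperGraph m n).Adj (u + v i) (u + v j))
    rw [add_comm u, add_comm u, leaperGraph_adj_add_right] at hij
    rcases hl.near_of_adj_vec hij with rfl | rfl
    exacts [⟨i, Or.inl List.infix_rfl⟩, ⟨j, Or.inr List.infix_rfl⟩]

lemma mem_shellPart_iff (hl : IsLifting m n n n' v t e) :
    x ∈ shellPart n n' i ↔ x - v i ∈ centeredBoard (n - m) := by
  have hne : ∀ i, ¬ IsSide i → (dirVec i).1 ≠ 0 ∧ (dirVec i).2 ≠ 0 := by decide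
  have habs {c d e t : ℤ} (he : e = 0 ∨ e = 1 ∨ e = -1) : |2 * (t - c * e)| < d ↔
      if e = 0 then |2 * t| < d else 2 * c - d < 2 * (e * t) ∧ 2 * (e * t) < 2 * c + d := by
    rcases he with rfl | rfl | rfl <;> simp [abs_lt, -abs_mul] <;> omega
  have := hl.lt
  have := hl.type
  have hv : v i = (if IsSide i then (n' - n : ℤ) else n) • dirVec i := by
    rw [hl.vec_eq, liftVec]
    split_ifs <;> rfl
  have hmem : x - v i ∈ centeredBoard (n - m) ↔
      |2 * (x.1 - (if IsSide i then (n' - n : ℤ) else n) * (dirVec i).1)| < n - m ∧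
        |2 * (x.2 - (if IsSide i then (n' - n : ℤ) else n) * (dirVec i).2)| < n - m := by
    rw [hv]; rfl
  rw [hmem, habs (dirVec_fst_eq i), habs (dirVec_snd_eq i)]
  by_cases hi : IsSide i
  · simp only [shellPart, if_pos hi]
    split_ifs <;> simp only [Set.mem_ofPred_eq] <;> omega
  · obtain ⟨h₁, h₂⟩ := hne i hi
    simp only [shellPart, if_neg hi, if_neg h₁, if_neg h₂]
    split_ifs <;> simp only [Set.mem_ofPred_eq] <;> omega

end IsLifting

lemma gVec_zero_one : gVec 0 1 = dirVec := by
  funext i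
  simp [gVec, liftVec]

lemma frame_one_two : frame 1 2 = Set.range dirVec := by
  refine Set.Subset.antisymm (fun x hx => ?_) ?_
  · obtain ⟨i, hi⟩ := exists_mem_frameSection (by decide) hx
    refine ⟨i, ?_⟩
    fin_cases i <;> simp only [mem_frameSection, dirVec, Fin.reduceFinMk, Matrix.cons_val,
      inStrip_zero, inStrip_one, inStrip_neg_one, Prod.ext_iff] at hi ⊢ <;> omega
  · rintro _ ⟨i, rfl⟩
    rw [← zero_add (dirVec i), ← gVec_zero_one]
    exact frameSection_subset one_lt_two i
      ((isLifting_g zero_lt_one (by decide)).add_vec_mem_of_mem_hole (by simp [centeredBoard]) i)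

end Shells

section Canonical

variable {m n n' p q r s : ℕ} {v : Fin 8 → Square} {t : Fin 2} {e : Fin 8}
  {S : Set Square} {w : Square} {z : Fin 8 → Square} {a : SectionPaths}

lemma IsLifting.shell_subset_frame (hl : IsLifting m n n n' v t e) :
    shell n n' ⊆ frame n n' := by
  rintro x ⟨i, hi⟩
  have := hl.add_vec_mem_of_mem_hole (hl.mem_shellPart_iff.1 hi) i
  rw [sub_add_cancel] at this
  exact frameSection_subset hl.lt' _ this

lemma IsLifting.exists_eq_add_vec_of_shell (hl : IsLifting m n n n' v t e)
    {C : (leaperGraph n n').Walk w w} (hC : C.IsCycle) (hshell : squares C ⊆ shell n n')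
    (hz : ∀ i, z i ∈ frameSection n n' i) (hS : squares C = Set.range z) :
    ∃ u, z = fun i => u + v i := by
  obtain ⟨i, hi⟩ := hshell (hS ▸ Set.mem_range_self 0 : z 0 ∈ squares C)
  have hu := hl.add_vec_mem_of_mem_hole (hl.mem_shellPart_iff.1 hi)
  have hcomp := isComponentOf_squares hl.lt' hl.odd' hC (hshell.trans hl.shell_subset_frame)
  have hrange : squares C = Set.range fun j => z 0 - v i + v j :=
    hcomp.eq_range hl hu (l := i) (by rw [sub_add_cancel, hS]; exact ⟨0, rfl⟩)
  refine ⟨z 0 - v i, funext fun j => ?_⟩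
  obtain ⟨k, hk⟩ : z j ∈ Set.range fun j => z 0 - v i + v j := hrange ▸ hS ▸ ⟨j, rfl⟩
  rw [← hk, frameSection_disjoint hl.lt' (hu k) (hk ▸ hz j)]

lemma isRadial_gVec (hmn : m < n) (u : Square) :
    IsRadial n (2 * n - m) n u fun i => [u + gVec m n i] := by
  intro i x hx
  have hcast : ((2 * n - m : ℕ) : ℤ) = 2 * n - m := by omega
  obtain rfl := List.mem_singleton.1 hx
  simp only [IsInner, IsOuter, abs_le, hcast, gVec, liftVec, Int.ModEq, Prod.fst_add, Prod.snd_add,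
    add_sub_cancel_left]
  fin_cases i <;>
    simp [dirVec, IsSide, Int.sign_eq_one_iff_pos, Int.sign_eq_neg_one_iff_neg] <;> omega

theorem BasicCanonical.isSecondTour (h : BasicCanonical p q S r s a) :
    IsSecondTour p q S r s a ∧ IsSpread p q s a := by
  induction h with
  | base =>
    have hl := isLifting_g zero_lt_one (by decide)
    have h := hl.isSecondTour_range (hl.add_vec_mem_of_mem_hole (u := 0) (by simp [centeredBoard]))
    simp only [zero_add, gVec_zero_one] at h
    rw [frame_one_two]
    exact ⟨h, Or.inl le_rfl⟩
  | gShell _ hmn hodd _ C hC hshell z hz hS =>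
    have hl := isLifting_g hmn hodd
    obtain ⟨u, rfl⟩ := hl.exists_eq_add_vec_of_shell hC hshell hz hS
    rw [hS]
    exact ⟨hl.isSecondTour_range hz, Or.inr ⟨u, isRadial_gVec hmn u⟩⟩
  | hShell _ hmn hodd _ C hC hshell z hz hS =>
    have hl := isLifting_h hmn hodd
    obtain ⟨u, rfl⟩ := hl.exists_eq_add_vec_of_shell hC hshell hz hS
    rw [hS]
    exact ⟨hl.isSecondTour_range hz, Or.inl (by omega)⟩
  | fLift _ ih =>
    obtain ⟨ih, -⟩ := ih
    have hs := ih.le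
    rw [fPaths_eq]
    exact ⟨ih.lift (isLifting_f ih.lt ih.odd) (Or.inl (by omega)), Or.inl (by omega)⟩
  | gLift _ ih =>
    obtain ⟨ih, hs⟩ := ih
    have hmn := ih.lt
    have hspread : IsSpread _ _ _ _ := hs.imp (fun hs => by omega) fun ⟨u, hu⟩ =>
      ⟨u, hu.gLift hmn ih.le (Nat.zero_lt_of_lt ih.lt')⟩
    rw [gPaths_eq]
    exact ⟨ih.lift (isLifting_g hmn ih.odd) hspread, hspread⟩
  | hLift _ ih =>
    obtain ⟨ih, -⟩ := ih
    have hs := ih.le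
    have hmn := ih.lt
    rw [hPaths_eq]
    exact ⟨ih.lift (isLifting_h hmn ih.odd) (Or.inl (by omega)), Or.inl (by omega)⟩

end Canonical

section Existence

variable {m n m' n' p q : ℕ} {v : Fin 8 → Square} {t : Fin 2} {e : Fin 8} {S : Set Square}

lemma IsComponentOf.exists_eq_liftSet_or_mem_centeredBoard (hl : IsLifting m n m' n' v t e)
    (hS : IsComponentOf (leaperGraph m' n') (frame m' n') S) :
    (∃ T, IsComponentOf (leaperGraph m n) (frame m n) T ∧ S = liftSet v m' n' T) ∨
      ∃ x ∈ S, ∃ i, x ∈ frameSection m' n' i ∧ x - v i ∈ centeredBoard (n - m) := by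
  obtain ⟨x, hx⟩ := hS.nonempty
  obtain ⟨i, hi⟩ := exists_mem_frameSection hl.odd' (hS.subset hx)
  by_cases hu : x - v i ∈ centeredBoard (n - m)
  · exact Or.inr ⟨x, hx, i, hi, hu⟩
  · have hne : (copySet v m n m' n' S).Nonempty :=
      ⟨_, sub_mem_copySet hx hi ⟨hl.sub_vec_mem_centeredBoard hi, hu⟩⟩
    exact Or.inl ⟨_, isComponentOf_copySet hl hS hne, hS.eq_liftSet_copySet hl hne⟩

lemma IsComponentOf.exists_eq_liftSet_or_eq_squares (hl : IsLifting m n n n' v t e)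
    (hS : IsComponentOf (leaperGraph n n') (frame n n') S) :
    (∃ T, IsComponentOf (leaperGraph m n) (frame m n) T ∧ S = liftSet v n n' T) ∨
      ∃ (u : Square) (C : (leaperGraph n n').Walk u u) (z : Fin 8 → Square), C.IsCycle ∧
        squares C ⊆ shell n n' ∧ (∀ i, z i ∈ frameSection n n' i) ∧ squares C = Set.range z ∧
          S = squares C := by
  refine (hS.exists_eq_liftSet_or_mem_centeredBoard hl).imp_right ?_
  rintro ⟨x, hx, i, -, hu⟩
  have hmem := hl.add_vec_mem_of_mem_hole hu
  obtain ⟨C, hC, hrange⟩ := hl.exists_isCycle hmem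
  refine ⟨_, C, _, hC, ?_, hmem, hrange, ?_⟩
  · rw [hrange]
    rintro _ ⟨j, rfl⟩
    exact ⟨j, hl.mem_shellPart_iff.2 (by rwa [add_sub_cancel_right])⟩
  · rw [hrange]
    exact hS.eq_range hl hmem (l := i) (by rwa [sub_add_cancel])

lemma sub_fVec_notMem_centeredBoard {x : Square} {i : Fin 8}
    (hx : x ∈ frameSection m (2 * m + n) i) : x - fVec m n i ∉ centeredBoard (n - m) := by
  induction i using direction_induction generalizing x with
  | add_two i ih =>
    obtain ⟨x, rfl⟩ := quarterTurn.surjective x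
    rw [quarterTurn_mem_frameSection] at hx
    rw [fVec, liftVec_add_two, ← map_sub, quarterTurn_mem_centeredBoard]
    exact ih hx
  | _ =>
    simp only [mem_frameSection, dirVec, Matrix.cons_val, inStrip_zero, inStrip_one] at hx
    simp +decide only [mem_centeredBoard, fVec, liftVec, dirVec, Matrix.cons_val, reduceIte,
      Prod.smul_mk, smul_eq_mul, Prod.fst_sub, Prod.snd_sub]
    omega

lemma IsComponentOf.exists_eq_liftSet_fVec (hmn : m < n) (hodd : Odd (m + n))
    (hS : IsComponentOf (leaperGraph m (2 * m + n)) (frame m (2 * m + n)) S) :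
    ∃ T, IsComponentOf (leaperGraph m n) (frame m n) T ∧
      S = liftSet (fVec m n) m (2 * m + n) T :=
  (hS.exists_eq_liftSet_or_mem_centeredBoard (isLifting_f hmn hodd)).resolve_right
    fun ⟨_, _, _, hx, hu⟩ => sub_fVec_notMem_centeredBoard hx hu

lemma IsComponentOf.eq_frame_one_two
    (hS : IsComponentOf (leaperGraph 1 2) (frame 1 2) S) : S = frame 1 2 := by
  have hl := isLifting_g zero_lt_one (by decide)
  have hmem := hl.add_vec_mem_of_mem_hole (u := 0) (by simp [centeredBoard])
  obtain ⟨x, hx⟩ := hS.nonempty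
  obtain ⟨i, rfl⟩ := frame_one_two ▸ hS.subset hx
  have := hS.eq_range hl hmem (l := i) (by rwa [zero_add, gVec_zero_one])
  rw [this, frame_one_two]
  simp only [zero_add, gVec_zero_one]

theorem IsComponentOf.exists_basicCanonical (hp : 0 < p) (hpq : p < q) (hco : Nat.Coprime p q)
    (hodd : Odd (p + q)) (hS : IsComponentOf (leaperGraph p q) (frame p q) S) :
    ∃ r s a, BasicCanonical p q S r s a := by
  induction q using Nat.strong_induction_on generalizing p S with
  | _ q ih =>
  obtain hq | rfl | hq := lt_trichotomy q (2 * p)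
  · obtain ⟨m, hm, rfl⟩ : ∃ m, m < p ∧ q = 2 * p - m := ⟨2 * p - q, by omega, by omega⟩
    have hco' : Nat.Coprime m p := by
      rw [show 2 * p - m = p + (p - m) by omega, Nat.coprime_self_add_right,
        Nat.coprime_self_sub_right hm.le] at hco
      exact hco.symm
    have hodd' : Odd (m + p) := by grind
    obtain ⟨T, hT, rfl⟩ | ⟨u, C, z, hC, hshell, hz, hrange, rfl⟩ :=
      hS.exists_eq_liftSet_or_eq_squares (isLifting_g hm hodd')
    · obtain ⟨r, s, a, ha⟩ := ih p hpq (by omega) hm hco' hodd' hT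
      exact ⟨r, s, _, ha.gLift⟩
    · exact ⟨m, p, _, .gShell (by omega) hm hodd' hco' C hC hshell z hz hrange⟩
  · obtain rfl : p = 1 := by rwa [Nat.Coprime, Nat.gcd_mul_left_right] at hco
    rw [hS.eq_frame_one_two]
    exact ⟨0, 1, _, .base⟩
  · obtain ⟨m, rfl⟩ : ∃ m, q = m + 2 * p := ⟨q - 2 * p, by omega⟩
    have hco' : Nat.Coprime m p := by simpa [Nat.coprime_comm] using hco
    have hodd' : Odd (m + p) := by grind
    obtain hm | rfl | hm := lt_trichotomy m p
    · obtain ⟨T, hT, rfl⟩ | ⟨u, C, z, hC, hshell, hz, hrange, rfl⟩ :=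
        hS.exists_eq_liftSet_or_eq_squares (isLifting_h hm hodd')
      · obtain ⟨r, s, a, ha⟩ := ih p hpq (by omega) hm hco' hodd' hT
        exact ⟨r, s, _, ha.hLift⟩
      · exact ⟨m, p, _, .hShell (by omega) hm hodd' hco' C hC hshell z hz hrange⟩
    · grind
    · rw [add_comm m] at hS ⊢
      rw [add_comm] at hodd'
      obtain ⟨T, hT, rfl⟩ := hS.exists_eq_liftSet_fVec hm hodd'
      obtain ⟨r, s, a, ha⟩ := ih m (by omega) hp hm hco'.symm hodd' hT
      exact ⟨r, s, _, ha.fLift⟩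

end Existence

section Tours

namespace SectionPaths

variable {a : SectionPaths} {w x y : Square} {A : List Square}

lemma mem_concat : x ∈ a.concat ↔ ∃ i, x ∈ a i := by
  simp [concat]

lemma nodup_concat (h : ∀ i, (a i).Nodup) (hd : ∀ i j x, x ∈ a i → x ∈ a j → i = j) :
    a.concat.Nodup :=
  List.nodup_flatMap.2 ⟨fun i _ => h i,
    (List.nodup_finRange 8).imp fun hij x hx hx' => hij (hd _ _ x hx hx')⟩

lemma concat_append_append (ha : a 0 = w :: A) :
    a.concat ++ [w] ++ A = (List.finRange 8 ++ [0]).flatMap a := by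
  simp [concat, ha]

lemma isChain_concat_append {R : Square → Square → Prop} (hne : ∀ i, a i ≠ [])
    (h : ∀ i, (a i ++ a (i + 1)).IsChain R) (ha : a 0 = w :: A) : (a.concat ++ [w]).IsChain R := by
  have hchain := isChain_flatMap hne h (l := List.finRange 8 ++ [0]) (by decide)
  rw [← concat_append_append ha] at hchain
  exact hchain.left_of_append

lemma Linked.pair_infix (h : a.Linked x y) (ha : a 0 = w :: A) :
    [x, y] <:+: a.concat ++ [w] ∨ [y, x] <:+: a.concat ++ [w] := by
  have hconcat : [w] ++ A <:+: a.concat := by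
    have hzero : [0] <:+: List.finRange 8 := by decide
    simpa [concat, ha] using hzero.flatMap a
  have hpair (i : Fin 8) (x y : Square) (h : [x, y] <:+: a i ++ a (i + 1)) :
      [x, y] <:+: a.concat ++ [w] := by
    have hpairs : ∀ i : Fin 8, [i, i + 1] <:+: List.finRange 8 ++ [0] := by decide
    have hlong := (hpairs i).flatMap a
    rw [← concat_append_append ha] at hlong
    obtain h | h :=
      pair_infix_append_append (List.cons_ne_nil w []) (h.trans (by simpa using hlong))
    · exact h
    · exact (h.trans hconcat).trans (List.infix_append' [] _ _)
  exact h.elim fun i => Or.imp (hpair i x y) (hpair i y x)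

lemma eight_le_length_concat (hne : ∀ i, a i ≠ []) : 8 ≤ a.concat.length := by
  have hsum := List.length_le_sum_of_one_le ((List.finRange 8).map fun i => (a i).length)
    (by simpa [Nat.one_le_iff_ne_zero] using hne)
  simpa [concat, List.length_flatMap] using hsum

end SectionPaths

theorem IsSecondTour.exists_isCycle {p q r s : ℕ} {S : Set Square} {a : SectionPaths}
    (h : IsSecondTour p q S r s a) : ∃ (w : Square) (E : (leaperGraph r s).Walk w w),
      E.IsCycle ∧ E.IsChordless ∧ E.support = a.concat ++ [w] ∧ squares E = S := by
  obtain ⟨w, A, ha⟩ := List.exists_cons_of_ne_nil (h.ne_nil 0)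
  obtain ⟨D, hD⟩ : ∃ D, a.concat = w :: D := by
    rw [SectionPaths.concat, List.finRange_succ, List.flatMap_cons, ha]
    exact ⟨_, rfl⟩
  have hnd := SectionPaths.nodup_concat h.nodup h.disjoint
  have hlen := SectionPaths.eight_le_length_concat h.ne_nil
  have hchain := SectionPaths.isChain_concat_append h.ne_nil h.chain ha
  rw [hD, List.length_cons] at hlen
  obtain ⟨E, hE, hsupp⟩ :=
    exists_isCycle_of_isChain (hD ▸ hnd) (by omega) (hD ▸ hchain)
  rw [← hD] at hsupp
  have hS : squares E = S := by
    ext x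
    have hw : ∃ i, w ∈ a i := ⟨0, ha ▸ List.mem_cons_self⟩
    simp only [squares, Set.mem_ofPred_eq, hsupp, h.mem_iff, List.mem_append, List.mem_singleton,
      SectionPaths.mem_concat]
    exact or_iff_left_of_imp fun hx => hx ▸ hw
  refine ⟨w, E, hE, SimpleGraph.Walk.isChordless_iff_forall_mem_edges.2 ?_, hsupp, hS⟩
  intro x y hx hy hxy
  rw [← SimpleGraph.Walk.infix_support_iff_mem_edges, hsupp]
  exact (h.linked x (hS ▸ hx) y (hS ▸ hy) hxy).pair_infix ha

end Tours

section Scaling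

variable {d p q r s : ℕ} {o : Square} {S : Set Square}

/-- Scaling by `d` followed by the translation by `t`, as an embedding of the leaper graph of an
`(r, s)`-leaper into that of a `(d * r, d * s)`-leaper. -/
def dilate (hd : 0 < d) (t : Square) (r s : ℕ) :
    leaperGraph r s ↪g leaperGraph (d * r) (d * s) where
  toFun x := t + (d : ℤ) • x
  inj' := (add_right_injective t).comp (smul_right_injective Square (by omega))
  map_rel_iff' := by
    simp [leaperGraph, ← mul_sub, Int.natAbs_mul, hd.ne', Prod.ext_iff]

lemma mem_range_dilate {hd : 0 < d} {t x : Square} :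
    x ∈ Set.range (dilate hd t r s) ↔ (d : ℤ) ∣ x.1 - t.1 ∧ (d : ℤ) ∣ x.2 - t.2 := by
  constructor
  · rintro ⟨y, rfl⟩
    simp [dilate]
  · rintro ⟨⟨a, ha⟩, b, hb⟩
    exact ⟨(a, b), Prod.ext (by simp [dilate, ← ha]) (by simp [dilate, ← hb])⟩

lemma mem_range_dilate_of_adj (hd : 0 < d) (t x y : Square)
    (hxy : (leaperGraph (d * r) (d * s)).Adj (dilate hd t r s x) y) :
    y ∈ Set.range (dilate hd t r s) := by
  have hx := mem_range_dilate.1 (Set.mem_range_self (f := dilate hd t r s) x)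
  have hdvd : (d : ℤ) ∣ y.1 - (dilate hd t r s x).1 ∧ (d : ℤ) ∣ y.2 - (dilate hd t r s x).2 := by
    rw [Int.natCast_dvd, Int.natCast_dvd]
    rcases hxy.2 with ⟨h₁, h₂⟩ | ⟨h₁, h₂⟩ <;> simp [h₁, h₂]
  exact mem_range_dilate.2 ⟨by simpa using dvd_add hdvd.1 hx.1, by simpa using dvd_add hdvd.2 hx.2⟩

lemma exists_dvd_sub_and_forall_mul_bounds (hd : 0 < d) {k : ℕ} (hk : Odd k) (a b : ℤ) :
    ∃ t : ℤ, (d : ℤ) ∣ b - t ∧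
      ∀ z : ℤ, a ≤ t + d * z ∧ t + d * z < a + (d * k : ℕ) ↔ |2 * z| < k := by
  obtain ⟨c, rfl⟩ := hk
  have hd' : (0 : ℤ) < d := by omega
  have hnonneg := Int.emod_nonneg (b - a) hd'.ne'
  have hlt := Int.emod_lt_of_pos (b - a) hd'
  refine ⟨a + (b - a) % d + d * c, ⟨(b - a) / d - c, ?_⟩, fun z => ?_⟩
  · linear_combination -Int.emod_add_mul_ediv (b - a) d
  · rw [abs_lt]
    push_cast
    constructor
    · rintro ⟨hlow, hhigh⟩
      have : -1 < z + c := by by_contra!; nlinarith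
      have : z + c < 2 * c + 1 := by by_contra!; nlinarith
      omega
    · rintro ⟨hlow, hhigh⟩
      have : 0 ≤ z + c := by omega
      have : z + c ≤ 2 * c := by omega
      constructor <;> nlinarith

lemma exists_dilate_preimage_chessboard (hd : 0 < d) (hodd : Odd (p + q)) (o x : Square) :
    ∃ t, x ∈ Set.range (dilate hd t p q) ∧
      dilate hd t p q ⁻¹' chessboard (d * p + d * q) o = centeredBoard (p + q) := by
  obtain ⟨t₁, hx₁, ht₁⟩ := exists_dvd_sub_and_forall_mul_bounds hd hodd o.1 x.1
  obtain ⟨t₂, hx₂, ht₂⟩ := exists_dvd_sub_and_forall_mul_bounds hd hodd o.2 x.2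
  refine ⟨(t₁, t₂), mem_range_dilate.2 ⟨hx₁, hx₂⟩, Set.ext fun y => ?_⟩
  rw [← mul_add]
  exact and_congr (by exact_mod_cast ht₁ y.1) (by exact_mod_cast ht₂ y.2)

lemma leaperGraph_comm (p q : ℕ) : leaperGraph p q = leaperGraph q p := by
  ext x y
  exact and_congr_right fun _ => or_comm

lemma encard_neighborSet_inter_chessboard_mul_le_two (hd : 0 < d) (hpq : p < q)
    (hodd : Odd (p + q)) {x : Square} (hx : x ∈ chessboard (d * p + d * q) o) :
    ((leaperGraph (d * p) (d * q)).neighborSet x ∩ chessboard (d * p + d * q) o).encard ≤ 2 := by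
  obtain ⟨t, ⟨x, rfl⟩, ht⟩ := exists_dilate_preimage_chessboard hd hodd o x
  have hsub : (leaperGraph (d * p) (d * q)).neighborSet (dilate hd t p q x) ∩
      chessboard (d * p + d * q) o ⊆
        dilate hd t p q '' ((leaperGraph p q).neighborSet x ∩ centeredBoard (p + q)) := by
    rintro y ⟨hxy, hy⟩
    obtain ⟨y, rfl⟩ := mem_range_dilate_of_adj hd t x y hxy
    exact ⟨y, ⟨(dilate hd t p q).map_adj_iff.1 hxy, ht ▸ hy⟩, rfl⟩
  calc _ ≤ _ := Set.encard_le_encard hsub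
    _ ≤ _ := Set.encard_image_le _ _
    _ ≤ 2 := encard_neighborSet_inter_centeredBoard_le_two hpq hodd (ht ▸ hx)

lemma encard_neighborSet_inter_chessboard_le_two (hodd : Odd (p + q)) {x : Square}
    (hx : x ∈ chessboard (p + q) o) :
    ((leaperGraph p q).neighborSet x ∩ chessboard (p + q) o).encard ≤ 2 := by
  wlog hpq : p < q generalizing p q
  · rw [leaperGraph_comm, add_comm]
    exact this (add_comm p q ▸ hodd) (add_comm p q ▸ hx) (by grind)
  rw [← one_mul p, ← one_mul q] at hx ⊢
  exact encard_neighborSet_inter_chessboard_mul_le_two one_pos hpq hodd hx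

lemma IsComponentOf.exists_dilate_preimage (hd : 0 < d) (hodd : Odd (p + q))
    (hS : IsComponentOf (leaperGraph (d * p) (d * q)) (chessboard (d * p + d * q) o) S)
    (hne : S.Nontrivial) : ∃ t, S ⊆ Set.range (dilate hd t p q) ∧
      IsComponentOf (leaperGraph p q) (frame p q) (dilate hd t p q ⁻¹' S) := by
  obtain ⟨x, hx⟩ := hS.nonempty
  obtain ⟨t, hxt, ht⟩ := exists_dilate_preimage_chessboard hd hodd o x
  have hrange := mem_range_dilate_of_adj (r := p) (s := q) hd t
  have hcomp := hS.preimage (dilate hd t p q) hrange ⟨x, hx, hxt⟩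
  rw [ht] at hcomp
  have hframe : dilate hd t p q ⁻¹' S ⊆ frame p q := by
    intro x hx
    obtain ⟨y, hy, hxy⟩ := hS.exists_adj hne hx
    obtain ⟨y, rfl⟩ := hrange x y hxy
    exact mem_frame_of_adj (hcomp.subset hx) (ht ▸ hy) ((dilate hd t p q).map_adj_iff.1 hxy)
  exact ⟨t, hS.subset_range hrange ⟨x, hx, hxt⟩, hcomp.mono hframe fun _ hx => hx.1⟩

lemma pos_of_mem_frame {x : Square} (hx : x ∈ frame p q) : 0 < p := by
  rw [frame_eq_diff, Set.mem_sdiff, mem_centeredBoard, mem_centeredBoard] at hx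
  omega

lemma IsComponentOf.exists_isCanonicalSecond (hodd : Odd (p + q))
    (hS : IsComponentOf (leaperGraph p q) (chessboard (p + q) o) S) (hne : S.Nontrivial) :
    ∃ r s D, IsCanonicalSecond p q S r s D := by
  wlog hpq : p < q generalizing p q
  · rw [leaperGraph_comm, add_comm] at hS
    simpa only [IsCanonicalSecond, Sym2.eq_swap (a := p)] using
      this (add_comm p q ▸ hodd) hS (by grind)
  obtain ⟨p', q', hco, hp, hq⟩ := Nat.exists_coprime p q
  have hd : 0 < p.gcd q := Nat.gcd_pos_of_pos_right p (by omega)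
  generalize p.gcd q = d at hd hp hq
  obtain ⟨rfl, rfl⟩ : p = d * p' ∧ q = d * q' := ⟨by rw [hp, mul_comm], by rw [hq, mul_comm]⟩
  have hodd' : Odd (p' + q') := by
    rw [← mul_add] at hodd
    exact (Nat.odd_mul.1 hodd).2
  obtain ⟨t, hrange, hcomp⟩ := hS.exists_dilate_preimage hd hodd' hne
  obtain ⟨x, hx⟩ := hcomp.nonempty
  obtain ⟨r, s, a, h⟩ := hcomp.exists_basicCanonical (pos_of_mem_frame (hcomp.subset hx))
    (Nat.lt_of_mul_lt_mul_left hpq) hco hodd'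
  exact ⟨d * r, d * s, _, p', q', r, s, d, t, _, a, h, hd, rfl,
    (Set.image_preimage_eq_of_subset hrange).symm, rfl, rfl, rfl⟩

theorem IsCanonicalSecond.exists_isCycle {D : List Square} (h : IsCanonicalSecond p q S r s D) :
    ∃ (w : Square) (E : (leaperGraph r s).Walk w w),
      E.IsCycle ∧ E.IsChordless ∧ E.support = D ++ [w] ∧ squares E = S := by
  obtain ⟨p', q', r, s, d, t, S, a, h, hd, -, rfl, rfl, rfl, rfl⟩ := h
  obtain ⟨w, E, hE, hch, hsupp, rfl⟩ := h.isSecondTour.1.exists_isCycle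
  refine ⟨_, E.map (dilate hd t r s).toHom, hE.map (dilate hd t r s).injective,
    isChordless_map _ hch, ?_, ?_⟩
  · rw [SimpleGraph.Walk.support_map, hsupp, List.map_append]
    rfl
  · ext x
    simp only [squares, SimpleGraph.Walk.support_map, List.mem_map]
    rfl

lemma IsCanonicalSecond.ne {D : List Square} (h : IsCanonicalSecond p q S r s D) :
    s(p, q) ≠ s(r, s) := by
  obtain ⟨p', q', r, s, d, t, S, a, h, hd, hpq, -, rfl, rfl, -⟩ := h
  obtain ⟨htour, -⟩ := h.isSecondTour
  have hrp := (htour.lt'.trans_le htour.le)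
  have hpq' := htour.lt
  rw [hpq, Ne, Sym2.eq_iff]
  simp only [Nat.mul_right_inj hd.ne']
  have := htour.le
  omega

end Scaling

theorem mainTheorem5 (p q : ℕ) (hpq : Odd (p + q)) (o u : Square)
    (C : (leaperGraph p q).Walk u u) (hC : C.IsCycle)
    (hboard : squares C ⊆ chessboard (p + q) o) :
    (∃ (r s : ℕ) (D : List Square), IsCanonicalSecond p q (squares C) r s D) ∧
    ∀ (r s : ℕ) (D : List Square), IsCanonicalSecond p q (squares C) r s D →
      (∃ (w : Square) (E : (leaperGraph r s).Walk w w), E.IsCycle ∧ E.support = D ++ [w] ∧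
        E.toSubgraph = (⊤ : (leaperGraph r s).Subgraph).induce (squares C)) ∧
      C.toSubgraph = (⊤ : (leaperGraph p q).Subgraph).induce (squares C) ∧
      IsDualBoard (squares C) p q r s := by
  have hdeg := fun x (hx : x ∈ chessboard (p + q) o) =>
    encard_neighborSet_inter_chessboard_le_two hpq hx
  have hCch := isChordless_of_encard_neighborSet_le_two hC hboard hdeg
  have hcomp := isComponentOf_of_encard_neighborSet_le_two hC hboard hdeg
  have hne : (squares C).Nontrivial :=
    ⟨u, C.start_mem_support, C.snd, C.getVert_mem_support 1, (C.adj_snd hC.not_nil).ne⟩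
  refine ⟨hcomp.exists_isCanonicalSecond hpq hne, fun r s D h => ?_⟩
  obtain ⟨w, E, hE, hEch, hsupp, hES⟩ := h.exists_isCycle
  exact ⟨⟨w, E, hE, hsupp, hES ▸ toSubgraph_eq_induce_of_isChordless hEch⟩,
    toSubgraph_eq_induce_of_isChordless hCch, h.ne, hne, C.connected_induce_support,
    hES ▸ E.connected_induce_support, nonempty_iso_of_isChordless hC hE hCch hEch hES.symm⟩
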